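/- Let $T>0$, $\alpha\ge 0$, $L\in\{1,2,\dots\}\cup\{\infty\}$, and write $[n]=\{1,\dots,n\}$, $[\infty]=\{1,2,\dots\}$. The $(L,\alpha)$-one-cold Poisson channel (OCPC) of duration $T$ takes as input a measurable function $x:[0,T]\to[L]$ and outputs counting processes $(Y_i(t))_{t\in[0,T]}$, $i\in[L]$, which are independent across $i$, where $Y_i$ is a Poisson process with intensity function $t\mapsto 1-(1-\alpha)\mathbf 1\{x(t)=i\}$. The perfect OCPC is the case $L=\infty$, $\alpha=0$. A code for $M$ messages consists of a measurable input $x(k,\cdot):[0,T]\to[L]$ for each $k\in[M]$ and of a measurable decoder that maps the output to $[M]$. Let $M^*(L,\alpha,T,\epsilon)$ be the largest number $M\ge 1$ of messages ($\infty$ if there is no bound) for which some code has average error probability at most $\epsilon$ for a uniformly distributed message, and let $\epsilon^*(L,\alpha,T,M)=\inf\{\epsilon\ge 0: M^*(L,\alpha,T,\epsilon)\ge M\}$. Theorem. Let $M\ge1$ be an integer with $L\ge M$. Let $Z_1\sim\mathrm{Poi}(\alpha T)$ and $Z_i\sim\mathrm{Poi}(T)$, $i=2,\dots,M$, be independent.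 If $\alpha\in[0,1]$, then $$\epsilon^*(L,\alpha,T,M)=\mathbb P(\hat K\ne 1),$$ where, conditionally on $(Z_i)_{i\in[M]}$, $\hat K$ is uniformly distributed over $\operatorname{argmin}_{i\in[M]}Z_i$. If $\alpha>1$, the same holds with $\operatorname{argmax}$ in place of $\operatorname{argmin}$. In both cases the optimum is attained by sending each message in its own band: for every injective $f:[M]\to[L]$, the inputs $x(k,t)=f(k)$, with a suitable decoder, have average error probability exactly $\epsilon^*(L,\alpha,T,M)$. In particular, for the perfect OCPC, $$\epsilon^*(\infty,0,T,M)=1-e^{T}M^{-1}\bigl(1-(1-e^{-T})^{M}\bigr)\qquad\text{for every integer } M\ge 1.$$ -/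

import Mathlib

open MeasureTheory ProbabilityTheory
open scoped NNReal ENNReal

namespace OCPC

/-- The index set of the bands: `{0, …, L - 1}` if `L` is finite, all of `ℕ` if `L = ∞`
(bands and messages are numbered from `0`). -/
abbrev Band (L : ℕ∞) : Type := {i : ℕ // (i : ℕ∞) < L}

/-- The time interval `[0, T]`. -/
abbrev Time (T : ℝ≥0) : Type := Set.Icc (0 : ℝ) (T : ℝ)

/-- The time `0`, as a point of `[0, T]`. -/
def Time.start (T : ℝ≥0) : Time T := ⟨0, le_refl 0, T.2⟩

/-- Paths of counting processes on `[0, T]`: nondecreasing right-continuous functions with values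
in `ℕ` that start at `0`. It carries the sigma-algebra generated by the evaluations. -/
abbrev CountingPath (T : ℝ≥0) : Type :=
  {y : Time T → ℕ //
    y (Time.start T) = 0 ∧ Monotone y ∧ ∀ t, ContinuousWithinAt y (Set.Ici t) t}

/-- The channel output: one counting path for each band (with the product sigma-algebra). -/
abbrev Output (L : ℕ∞) (T : ℝ≥0) : Type := Band L → CountingPath T

/-- The intensity `1 - (1 - α) 1{x(τ) = i}` of the process of band `i` at time `τ`, if the input
is `x`. -/
noncomputable def intensity {L : ℕ∞} {T : ℝ≥0} (α : ℝ≥0) (x : Time T → Band L) (i : Band L)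
    (τ : Time T) : ℝ :=
  1 - (1 - (α : ℝ)) * (if x τ = i then 1 else 0)

/-- `P` is the law of the output of the one-cold Poisson channel with `L` bands, leakage `α` and
duration `T` for the input `x`: under `P`, the bands are independent, and the output of band `i`
is a Poisson process with intensity function `intensity α x i`, that is, it has independent
increments, and its increment over `(t₀, t₁]` is Poisson with parameter the integral of the intensity over
that interval, for Lebesgue measure. -/
structure IsOutputLaw {L : ℕ∞} {T : ℝ≥0} (α : ℝ≥0) (x : Time T → Band L)
    (P : Measure (Output L T)) : Prop where
  isProbabilityMeasure : IsProbabilityMeasure P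
  indep_bands : iIndepFun (fun (i : Band L) (y : Output L T) => y i) P
  indep_increments : ∀ i : Band L,
    HasIndepIncrements (fun (t : Time T) (y : Output L T) => (y i).1 t) P
  law_increment : ∀ (i : Band L) (t₀ t₁ : Time T), t₀ < t₁ →
    HasLaw (fun y : Output L T => (y i).1 t₁ - (y i).1 t₀)
      (poissonMeasure (∫ τ in Set.Ioc t₀ t₁, intensity α x i τ
        ∂(Measure.comap Subtype.val volume : Measure (Time T))).toNNReal) P

/-- A coding scheme for `M` messages: a channel input for each message, and a decoder. -/
structure Code (L : ℕ∞) (T : ℝ≥0) (M : ℕ) where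
  enc : Fin M → Time T → Band L
  measurable_enc : ∀ k, Measurable (enc k)
  dec : Output L T → Fin M
  measurable_dec : Measurable dec

/-- `e` is the average error probability of the code `c` over the channel, for a message that is
uniformly distributed over the `M` possible values. -/
def Code.HasErrorProb {L : ℕ∞} {T : ℝ≥0} {M : ℕ} (c : Code L T M) (α : ℝ≥0) (e : ℝ) : Prop :=
  ∃ P : Fin M → Measure (Output L T), (∀ k, IsOutputLaw α (c.enc k) (P k)) ∧
    e = (∑ k, (P k).real {y | c.dec y ≠ k}) / M

/-- The largest number of messages (`∞` if there is no bound) that can be sent with average error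
probability at most `ε`. -/
noncomputable def maxMessages (L : ℕ∞) (α T : ℝ≥0) (ε : ℝ) : ℕ∞ :=
  sSup {m : ℕ∞ | ∃ M : ℕ, 1 ≤ M ∧ m = M ∧
    ∃ (c : Code L T M) (e : ℝ), c.HasErrorProb α e ∧ e ≤ ε}

/-- The optimal error probability for `M` messages. -/
noncomputable def optError (L : ℕ∞) (α T : ℝ≥0) (M : ℕ) : ℝ :=
  sInf {ε : ℝ | 0 ≤ ε ∧ (M : ℕ∞) ≤ maxMessages L α T ε}

/-- The set of the indices where `z` is smallest. -/
def argminSet {M : ℕ} (z : Fin M → ℕ) : Set (Fin M) := {k | ∀ j, z k ≤ z j}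

/-- The set of the indices where `z` is largest. -/
def argmaxSet {M : ℕ} (z : Fin M → ℕ) : Set (Fin M) := {k | ∀ j, z j ≤ z k}

/-- The law of independent Poisson variables `Z i`, where the one with index `0` has mean `α T`,
and all the others have mean `T`. -/
noncomputable def countLaw (α T : ℝ≥0) (M : ℕ) [NeZero M] : Measure (Fin M → ℕ) :=
  Measure.pi (fun i => poissonMeasure (if i = 0 then α * T else T))

/-- The law of an index that, conditionally on the variables `Z` with law `countLaw α T M`, is
uniformly distributed over the set `S Z`. -/
noncomputable def guessLaw (α T : ℝ≥0) (M : ℕ) [NeZero M]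
    (S : (Fin M → ℕ) → Set (Fin M)) : Measure (Fin M) :=
  (countLaw α T M).bind (fun z => uniformOn (S z))

end OCPC

/-!
Given message `k`, the likelihood of the output, relative to rate-one Poisson processes in all the
bands, is `exp ((1 - α) T) * α ^ N k`, where `N k` counts the points that occur in the band to which
the input of message `k` points at that time; under the reference law, `N k` is Poisson with mean
`T`. Hence the probability of correct decoding is at most `exp ((1 - α) T) / M` times the
expectation of `max_k α ^ N k`.

The variables `N k` are sums over subfamilies of one family of independent Poisson variables. They
are therefore associated (Harris' inequality), so that the expected maximum does not decrease if
they are replaced by independent copies, and these are the counts of inputs that keep every message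
in its own band. For such inputs the optimal decoder picks a maximizer of `α ^ N k`, and by symmetry
a uniform guess among the maximizers is right equally often for every message.

The likelihood is only computed for finitely many increments of the output; an arbitrary decoder
is approximated by decoders that depend on finitely many of them.
-/

namespace OCPC

section Association

/-- `mul_add_mul_le_mul_add_mul` needs cancellation, which fails in `ℝ≥0∞`. -/
theorem mul_add_mul_le_of_canonicallyOrdered {R : Type*} [CommSemiring R] [PartialOrder R]
    [CanonicallyOrderedAdd R] {a b c d : R} (hab : a ≤ b) (hcd : c ≤ d) :
    a * d + b * c ≤ a * c + b * d := by
  obtain ⟨e, rfl⟩ := exists_add_of_le hab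
  obtain ⟨f, rfl⟩ := exists_add_of_le hcd
  calc a * (c + f) + (a + e) * c ≤ a * (c + f) + (a + e) * c + e * f := le_self_add
    _ = a * c + (a + e) * (c + f) := by ring

/-- **Chebyshev's integral inequality**. -/
theorem lintegral_mul_lintegral_le_of_monovary {X : Type*} [MeasurableSpace X] (μ : Measure X)
    [IsProbabilityMeasure μ] {f g : X → ℝ≥0∞} (hf : Measurable f) (hg : Measurable g)
    (hfg : Monovary f g) :
    (∫⁻ x, f x ∂μ) * ∫⁻ x, g x ∂μ ≤ ∫⁻ x, f x * g x ∂μ := by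
  have rearrangement (x y : X) : f x * g y + f y * g x ≤ f x * g x + f y * g y := by
    rcases lt_trichotomy (g x) (g y) with h | h | h
    · exact mul_add_mul_le_of_canonicallyOrdered (hfg h) h.le
    · rw [h]
    · rw [add_comm, add_comm (f x * g x)]
      exact mul_add_mul_le_of_canonicallyOrdered (hfg h) h.le
  have doubled : ∫⁻ x, ∫⁻ y, (f x * g y + f y * g x) ∂μ ∂μ ≤
      ∫⁻ x, ∫⁻ y, (f x * g x + f y * g y) ∂μ ∂μ :=
    lintegral_mono fun x ↦ lintegral_mono (rearrangement x)
  have inner_left (x : X) : ∫⁻ y, (f x * g y + f y * g x) ∂μ =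
      f x * (∫⁻ y, g y ∂μ) + (∫⁻ y, f y ∂μ) * g x := by
    rw [lintegral_add_left (by fun_prop), lintegral_const_mul _ hg, lintegral_mul_const _ hf]
  have inner_right (x : X) : ∫⁻ y, (f x * g x + f y * g y) ∂μ =
      f x * g x + ∫⁻ y, f y * g y ∂μ := by
    rw [lintegral_add_left measurable_const, lintegral_const, measure_univ, mul_one]
  simp_rw [inner_left, inner_right] at doubled
  rw [lintegral_add_left (by fun_prop), lintegral_add_left (by fun_prop),
    lintegral_mul_const _ hf, lintegral_const_mul _ hg, lintegral_const, measure_univ, mul_one,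
    ← two_mul, ← two_mul] at doubled
  exact (ENNReal.mul_le_mul_iff_right two_ne_zero ENNReal.ofNat_ne_top).1 doubled

theorem updateFinset_mono {ι : Type*} [DecidableEq ι] {X : ι → Type*} [∀ i, Preorder (X i)]
    (s : Finset ι) (z : ∀ i : s, X i) :
    Monotone fun x : ∀ i, X i ↦ Function.updateFinset x s z := fun x y hxy i ↦ by
  by_cases hi : i ∈ s <;> simp [Function.updateFinset, hi, hxy i]

variable {ι : Type*} {X : ι → Type*} [∀ i, MeasurableSpace (X i)] (μ : ∀ i, Measure (X i))

section Marginal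

variable [DecidableEq ι]

theorem monotone_lmarginal [∀ i, Preorder (X i)] (s : Finset ι) {f : (∀ i, X i) → ℝ≥0∞}
    (hf : Monotone f) : Monotone (lmarginal μ s f) := fun _ _ hxy ↦
  lintegral_mono fun z ↦ hf (updateFinset_mono s z hxy)

theorem antitone_lmarginal [∀ i, Preorder (X i)] (s : Finset ι) {f : (∀ i, X i) → ℝ≥0∞}
    (hf : Antitone f) : Antitone (lmarginal μ s f) := fun _ _ hxy ↦
  lintegral_mono fun z ↦ hf (updateFinset_mono s z hxy)

variable [∀ i, LinearOrder (X i)] [∀ i, IsProbabilityMeasure (μ i)]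

theorem lmarginal_mul_lmarginal_le {f g : (∀ i, X i) → ℝ≥0∞} (hf : Measurable f)
    (hg : Measurable g) (h : Monotone f ∧ Monotone g ∨ Antitone f ∧ Antitone g) (s : Finset ι) :
    lmarginal μ s f * lmarginal μ s g ≤ lmarginal μ s (f * g) := by
  induction s using Finset.induction_on with
  | empty => simp
  | insert i s hi ih =>
    intro x
    have monovary_update : Monovary (fun a ↦ lmarginal μ s f (Function.update x i a))
        (fun a ↦ lmarginal μ s g (Function.update x i a)) := by
      have hx : Monotone (Function.update x i) := Function.update_mono
      rcases h with ⟨hf, hg⟩ | ⟨hf, hg⟩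
      · exact ((monotone_lmarginal μ s hf).comp hx).monovary ((monotone_lmarginal μ s hg).comp hx)
      · exact ((antitone_lmarginal μ s hf).comp_monotone hx).monovary
          ((antitone_lmarginal μ s hg).comp_monotone hx)
    rw [Pi.mul_apply, lmarginal_insert _ hf hi, lmarginal_insert _ hg hi,
      lmarginal_insert _ (hf.mul hg) hi]
    exact (lintegral_mul_lintegral_le_of_monovary (μ i)
      ((hf.lmarginal μ).comp (measurable_update x)) ((hg.lmarginal μ).comp (measurable_update x))
      monovary_update).trans (lintegral_mono fun y ↦ ih _)

end Marginal

variable [Fintype ι] [∀ i, LinearOrder (X i)] [∀ i, IsProbabilityMeasure (μ i)]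

/-- **Harris' inequality**. -/
theorem lintegral_pi_mul_lintegral_pi_le {f g : (∀ i, X i) → ℝ≥0∞} (hf : Measurable f)
    (hg : Measurable g) (h : Monotone f ∧ Monotone g ∨ Antitone f ∧ Antitone g) :
    (∫⁻ x, f x ∂Measure.pi μ) * ∫⁻ x, g x ∂Measure.pi μ ≤ ∫⁻ x, f x * g x ∂Measure.pi μ := by
  classical
  obtain ⟨x⟩ : Nonempty (∀ i, X i) := nonempty_of_isProbabilityMeasure (Measure.pi μ)
  simpa [lmarginal_univ] using lmarginal_mul_lmarginal_le μ hf hg h Finset.univ x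

theorem prod_lintegral_pi_le {κ : Type*} (s : Finset κ) {f : κ → (∀ i, X i) → ℝ≥0∞}
    (hf : ∀ k, Measurable (f k)) (h : (∀ k, Monotone (f k)) ∨ ∀ k, Antitone (f k)) :
    ∏ k ∈ s, ∫⁻ x, f k x ∂Measure.pi μ ≤ ∫⁻ x, ∏ k ∈ s, f k x ∂Measure.pi μ := by
  classical
  induction s using Finset.induction_on with
  | empty => simp
  | insert i s hi ih =>
    simp_rw [Finset.prod_insert hi]
    refine (mul_le_mul_right ih _).trans
      (lintegral_pi_mul_lintegral_pi_le μ (hf i) (by fun_prop) ?_)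
    exact h.imp (fun h ↦ ⟨h i, fun x y hxy ↦ Finset.prod_le_prod' fun k _ ↦ h k hxy⟩)
      (fun h ↦ ⟨h i, fun x y hxy ↦ Finset.prod_le_prod' fun k _ ↦ h k hxy⟩)

theorem prod_measure_pi_le_le {κ : Type*} [Fintype κ] {g : κ → (∀ i, X i) → ℝ≥0∞}
    (hg : ∀ k, Measurable (g k)) (h : (∀ k, Monotone (g k)) ∨ ∀ k, Antitone (g k)) (t : ℝ≥0∞) :
    ∏ k, Measure.pi μ {x | g k x ≤ t} ≤ Measure.pi μ {x | ∀ k, g k x ≤ t} := by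
  have measurableSet_le (k : κ) : MeasurableSet {x | g k x ≤ t} := hg k measurableSet_Iic
  have antitone_indicator : Antitone ((Set.Iic t).indicator (1 : ℝ≥0∞ → ℝ≥0∞)) := by
    intro a b hab
    by_cases hb : b ≤ t
    · simp [hb, hab.trans hb]
    · simp [hb]
  have harris := prod_lintegral_pi_le μ Finset.univ
    (f := fun k x ↦ (Set.Iic t).indicator 1 (g k x))
    (fun k ↦ (measurable_one.indicator measurableSet_Iic).comp (hg k))
    (h.symm.imp (fun h k ↦ antitone_indicator.comp (h k))
      fun h k ↦ antitone_indicator.comp_monotone (h k))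
  have prod_indicator (x : ∀ i, X i) : ∏ k, (Set.Iic t).indicator (1 : ℝ≥0∞ → ℝ≥0∞) (g k x) =
      Set.indicator {x | ∀ k, g k x ≤ t} 1 x := by
    simp only [Set.indicator_apply, Set.mem_Iic, Set.mem_ofPred, Pi.one_apply,
      Finset.prod_ite_zero, Finset.prod_const_one, Finset.mem_univ, true_imp_iff]
  have lintegral_indicator (k : κ) :
      ∫⁻ x, (Set.Iic t).indicator 1 (g k x) ∂Measure.pi μ = Measure.pi μ {x | g k x ≤ t} :=
    lintegral_indicator_one (measurableSet_le k)
  simp_rw [prod_indicator, lintegral_indicator] at harris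
  rwa [lintegral_indicator_one (by measurability)] at harris

/-- Unlike `lintegral_eq_lintegral_meas_lt`, this allows the value `∞`. -/
theorem lintegral_eq_lintegral_Ioi_measure_lt {Ω : Type*} [MeasurableSpace Ω] (P : Measure Ω)
    [SFinite P] {f : Ω → ℝ≥0∞} (hf : Measurable f) :
    ∫⁻ ω, f ω ∂P = ∫⁻ t in Set.Ioi (0 : ℝ), P {ω | ENNReal.ofReal t < f ω} := by
  have volume_eq (a : ℝ≥0∞) : volume.restrict (Set.Ioi 0) {t : ℝ | ENNReal.ofReal t < a} = a := by
    rw [Measure.restrict_apply (measurableSet_lt (by fun_prop) measurable_const)]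
    induction a with
    | top => simp
    | coe a =>
      have : {t : ℝ | ENNReal.ofReal t < a} ∩ Set.Ioi 0 = Set.Ioo 0 (a : ℝ) := by
        ext t
        simp +contextual [and_comm, ENNReal.ofReal_lt_coe_iff, le_of_lt]
      rw [this, Real.volume_Ioo, sub_zero, ENNReal.ofReal_coe_nnreal]
  have hm : MeasurableSet {p : Ω × ℝ | ENNReal.ofReal p.2 < f p.1} :=
    measurableSet_lt (by fun_prop) (by fun_prop)
  calc ∫⁻ ω, f ω ∂P
      = P.prod (volume.restrict (Set.Ioi 0)) {p | ENNReal.ofReal p.2 < f p.1} := by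
        rw [Measure.prod_apply hm]
        exact lintegral_congr fun ω ↦ (volume_eq (f ω)).symm
    _ = ∫⁻ t in Set.Ioi (0 : ℝ), P {ω | ENNReal.ofReal t < f ω} := Measure.prod_apply_symm hm

theorem lintegral_iSup_pi_le {κ : Type*} [Fintype κ] {g : κ → (∀ i, X i) → ℝ≥0∞}
    (hg : ∀ k, Measurable (g k)) (h : (∀ k, Monotone (g k)) ∨ ∀ k, Antitone (g k)) :
    ∫⁻ x, ⨆ k, g k x ∂Measure.pi μ ≤
      ∫⁻ z, ⨆ k, z k ∂Measure.pi fun k ↦ (Measure.pi μ).map (g k) := by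
  have (k : κ) : IsProbabilityMeasure ((Measure.pi μ).map (g k)) :=
    Measure.isProbabilityMeasure_map (hg k).aemeasurable
  rw [lintegral_eq_lintegral_Ioi_measure_lt _ (.iSup hg),
    lintegral_eq_lintegral_Ioi_measure_lt _ (.iSup measurable_pi_apply)]
  refine lintegral_mono fun t ↦ ?_
  set u := ENNReal.ofReal t
  have compl_eq : {x | u < ⨆ k, g k x} = {x | ∀ k, g k x ≤ u}ᶜ := by ext; simp [lt_iSup_iff]
  have compl_eq' : {z : κ → ℝ≥0∞ | u < ⨆ k, z k} = (Set.univ.pi fun _ ↦ Set.Iic u)ᶜ := by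
    ext; simp [lt_iSup_iff, Pi.le_def]
  rw [compl_eq, compl_eq', prob_compl_eq_one_sub (by measurability),
    prob_compl_eq_one_sub (.univ_pi fun _ ↦ measurableSet_Iic), Measure.pi_pi]
  simp_rw [Measure.map_apply (hg _) measurableSet_Iic]
  exact tsub_le_tsub_left (prod_measure_pi_le_le μ hg h u) 1

end Association

section GeneratingFunction

variable {κ : Type*} [Fintype κ]

theorem ext_of_integral_prod_pow {μ ν : Measure (κ → ℕ)} [IsFiniteMeasure μ]
    [IsFiniteMeasure ν] (h : ∀ z : κ → ℂ, (∀ c, ‖z c‖ = 1) →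
      ∫ n, ∏ c, z c ^ n c ∂μ = ∫ n, ∏ c, z c ^ n c ∂ν) : μ = ν := by
  classical
  let castReal : (κ → ℕ) → κ → ℝ := fun n c ↦ n c
  have castReal_injective : castReal.Injective := fun _ _ h ↦
    funext fun c ↦ Nat.cast_injective (congrFun h c)
  have castReal_embedding : MeasurableEmbedding castReal :=
    ⟨castReal_injective, .of_discrete, fun s _ ↦ (s.to_countable.image _).measurableSet⟩
  have charFunDual_map (ρ : Measure (κ → ℕ)) (ℓ : StrongDual ℝ (κ → ℝ)) :
      charFunDual (ρ.map castReal) ℓ =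
        ∫ n, ∏ c, Complex.exp (ℓ (Pi.single c 1) * Complex.I) ^ n c ∂ρ := by
    rw [charFunDual_apply, castReal_embedding.integral_map]
    refine integral_congr_ae (.of_forall fun n ↦ ?_)
    have : ℓ (castReal n) = ∑ c, n c * ℓ (Pi.single c 1) := by
      conv_lhs => rw [pi_eq_sum_univ' (castReal n), map_sum]
      simp [castReal]
    simp only [this, ← Complex.exp_nat_mul, ← Complex.exp_sum]
    push_cast
    rw [Finset.sum_mul]
    simp only [mul_assoc]
  refine castReal_embedding.map_injective (Measure.ext_of_charFunDual (funext fun ℓ ↦ ?_))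
  rw [charFunDual_map, charFunDual_map]
  exact h _ fun c ↦ Complex.norm_exp_ofReal_mul_I _

theorem integral_pow_poissonMeasure (r : ℝ≥0) (z : ℂ) :
    ∫ n, z ^ n ∂poissonMeasure r = Complex.exp (r * (z - 1)) := by
  calc ∫ n, z ^ n ∂poissonMeasure r
      = ∑' n : ℕ, Complex.exp (-r) * ((r * z) ^ n / n.factorial) := by
        rw [integral_poissonMeasure]
        congr with n
        rw [Complex.real_smul]
        push_cast
        rw [mul_pow]
        ring
    _ = Complex.exp (-r) * Complex.exp (r * z) := by
        rw [tsum_mul_left, (NormedSpace.expSeries_div_hasSum_exp (r * z : ℂ)).tsum_eq,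
          Complex.exp_eq_exp_ℂ]
    _ = Complex.exp (r * (z - 1)) := by
        rw [← Complex.exp_add]
        ring_nf

theorem integral_prod_pow_pi_poissonMeasure (r : κ → ℝ≥0) (z : κ → ℂ) :
    ∫ n, ∏ c, z c ^ n c ∂Measure.pi (fun c ↦ poissonMeasure (r c)) =
      Complex.exp (∑ c, r c * (z c - 1)) := by
  rw [integral_fintype_prod_eq_prod (fun c n ↦ z c ^ n), Complex.exp_sum]
  simp_rw [integral_pow_poissonMeasure]

theorem hasLaw_pi_poissonMeasure_of_integral_prod_pow {Ω : Type*} [MeasurableSpace Ω]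
    {P : Measure Ω} [IsFiniteMeasure P] {X : Ω → κ → ℕ} (hX : Measurable X) (r : κ → ℝ≥0)
    (h : ∀ z : κ → ℂ, (∀ c, ‖z c‖ = 1) →
      ∫ ω, ∏ c, z c ^ X ω c ∂P = Complex.exp (∑ c, r c * (z c - 1))) :
    HasLaw X (Measure.pi fun c ↦ poissonMeasure (r c)) P where
  map_eq := ext_of_integral_prod_pow fun z hz ↦ by
    rw [integral_map hX.aemeasurable Measurable.of_discrete.aestronglyMeasurable, h z hz,
      integral_prod_pow_pi_poissonMeasure]

theorem prod_pow_indicator_eq {E R : Type*} [CommRing R] {A : κ → Set E}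
    (hA : Pairwise fun c d ↦ Disjoint (A c) (A d)) (z : κ → R) (e : E) :
    ∏ c, z c ^ (A c).indicator (1 : E → ℕ) e = 1 + ∑ c, (A c).indicator (fun _ ↦ z c - 1) e := by
  classical
  by_cases he : ∃ c, e ∈ A c
  · obtain ⟨c, hc⟩ := he
    have notMem (d : κ) (hd : d ≠ c) : e ∉ A d := Set.disjoint_left.1 (hA hd.symm) hc
    rw [Finset.prod_eq_single c (by simp +contextual [notMem]) (by simp),
      Finset.sum_eq_single c (by simp +contextual [notMem]) (by simp)]
    simp [hc]
  · push Not at he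
    simp [he]

/-- **Superposition theorem** for Poisson variables. -/
theorem hasLaw_sum_pi_poissonMeasure {ι : Type*} [Fintype ι] (r : ι → ℝ≥0) {s : κ → Finset ι}
    (hs : Pairwise fun c d ↦ Disjoint (s c) (s d)) :
    HasLaw (fun (n : ι → ℕ) c ↦ ∑ i ∈ s c, n i)
      (Measure.pi fun c ↦ poissonMeasure (∑ i ∈ s c, r i))
      (Measure.pi fun i ↦ poissonMeasure (r i)) := by
  classical
  refine hasLaw_pi_poissonMeasure_of_integral_prod_pow .of_discrete _ fun z _ ↦ ?_
  let w : ι → ℂ := fun i ↦ ∏ c, z c ^ Set.indicator (s c) (1 : ι → ℕ) i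
  have prod_pow_sum (n : ι → ℕ) : ∏ c, z c ^ ∑ i ∈ s c, n i = ∏ i, w i ^ n i := by
    simp_rw [w, ← Finset.prod_pow, ← pow_mul]
    rw [Finset.prod_comm]
    refine Finset.prod_congr rfl fun c _ ↦ ?_
    rw [← Finset.prod_pow_eq_pow_sum, ← Finset.prod_subset (Finset.subset_univ (s c))]
    · exact Finset.prod_congr rfl fun i hi ↦ by simp [hi]
    · exact fun i _ hi ↦ by simp [hi]
  have w_eq (i : ι) : w i - 1 = ∑ c, if i ∈ s c then z c - 1 else 0 := by
    rw [show w i = _ from prod_pow_indicator_eq (fun c d h ↦ Finset.disjoint_coe.2 (hs h)) z i,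
      add_sub_cancel_left]
    simp only [Set.indicator_apply, Finset.mem_coe]
  simp_rw [prod_pow_sum, integral_prod_pow_pi_poissonMeasure, w_eq, Finset.mul_sum]
  rw [Finset.sum_comm]
  simp [Finset.sum_mul]

theorem hasLaw_sum_poissonMeasure {ι : Type*} [Fintype ι] (r : ι → ℝ≥0) (s : Finset ι) :
    HasLaw (fun n : ι → ℕ ↦ ∑ i ∈ s, n i) (poissonMeasure (∑ i ∈ s, r i))
      (Measure.pi fun i ↦ poissonMeasure (r i)) :=
  (measurePreserving_eval (fun _ : Unit ↦ poissonMeasure (∑ i ∈ s, r i)) ()).hasLaw.fun_comp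
    (hasLaw_sum_pi_poissonMeasure r (s := fun _ : Unit ↦ s) Subsingleton.pairwise)

end GeneratingFunction

section Likelihood

variable {ι : Type*} [Fintype ι]

theorem poissonMeasure_mul_singleton (a r : ℝ≥0) (n : ℕ) :
    poissonMeasure (a * r) {n} =
      ENNReal.ofReal (Real.exp ((1 - a) * r)) * (a : ℝ≥0∞) ^ n * poissonMeasure r {n} := by
  have exp_eq : Real.exp (-(a * r : ℝ)) = Real.exp ((1 - a) * r) * Real.exp (-r) := by
    rw [← Real.exp_add]
    ring_nf
  rw [poissonMeasure_singleton, poissonMeasure_singleton, ← ENNReal.ofReal_coe_nnreal (p := a),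
    ← ENNReal.ofReal_pow a.coe_nonneg, ← ENNReal.ofReal_mul (by positivity),
    ← ENNReal.ofReal_mul (by positivity)]
  congr 1
  push_cast
  rw [exp_eq, mul_pow]
  ring

theorem pi_poissonMeasure_mul (a r : ι → ℝ≥0) :
    Measure.pi (fun i ↦ poissonMeasure (a i * r i)) =
      (Measure.pi fun i ↦ poissonMeasure (r i)).withDensity (fun n ↦
        ENNReal.ofReal (Real.exp (∑ i, (1 - (a i : ℝ)) * r i)) * ∏ i, (a i : ℝ≥0∞) ^ n i) := by
  refine Measure.ext_of_singleton fun n ↦ ?_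
  rw [withDensity_apply _ (measurableSet_singleton _), lintegral_singleton, Measure.pi_singleton,
    Measure.pi_singleton]
  simp_rw [poissonMeasure_mul_singleton, Finset.prod_mul_distrib]
  rw [Real.exp_sum, ENNReal.ofReal_prod_of_nonneg fun i _ ↦ by positivity]

theorem pi_poissonMeasure_ite_apply (α : ℝ≥0) (r : ι → ℝ≥0) (p : ι → Prop) [DecidablePred p]
    (A : Set (ι → ℕ)) :
    Measure.pi (fun i ↦ poissonMeasure ((if p i then α else 1) * r i)) A =
      ENNReal.ofReal (Real.exp ((1 - α) * ∑ i with p i, (r i : ℝ))) *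
        ∫⁻ n in A, (α : ℝ≥0∞) ^ (∑ i with p i, n i) ∂Measure.pi fun i ↦ poissonMeasure (r i) := by
  rw [pi_poissonMeasure_mul, withDensity_apply _ .of_discrete,
    lintegral_const_mul _ .of_discrete]
  congr 2
  · congr 2
    rw [Finset.mul_sum, Finset.sum_filter]
    exact Finset.sum_congr rfl fun i _ ↦ by split_ifs <;> simp
  · ext n
    rw [← Finset.prod_pow_eq_pow_sum, Finset.prod_filter]
    exact Finset.prod_congr rfl fun i _ ↦ by split_ifs <;> simp

end Likelihood

/-- The expectation of `max_k α ^ Z_k` for independent Poisson variables `Z_k` of mean `T`, times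
the normalizing constant of the likelihood ratios. It is the number of messages times the optimal
probability of correct decoding. -/
noncomputable def optimalScore (α T : ℝ≥0) (M : ℕ) : ℝ≥0∞ :=
  ENNReal.ofReal (Real.exp ((1 - α) * T)) *
    ∫⁻ z, ⨆ k : Fin M, (α : ℝ≥0∞) ^ z k ∂Measure.pi fun _ : Fin M ↦ poissonMeasure T

section Score

variable {ι : Type*} [Fintype ι] {M : ℕ}

theorem lintegral_iSup_pow_sum_le (α : ℝ≥0) (r : ι → ℝ≥0) (T : ℝ≥0) (s : Fin M → Finset ι)
    (hs : ∀ k, ∑ i ∈ s k, r i = T) :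
    ∫⁻ n, ⨆ k : Fin M, (α : ℝ≥0∞) ^ (∑ i ∈ s k, n i) ∂Measure.pi (fun i ↦ poissonMeasure (r i)) ≤
      ∫⁻ z, ⨆ k : Fin M, (α : ℝ≥0∞) ^ z k ∂Measure.pi fun _ : Fin M ↦ poissonMeasure T := by
  have monotone_sum (k : Fin M) : Monotone fun n : ι → ℕ ↦ ∑ i ∈ s k, n i :=
    fun n m hnm ↦ Finset.sum_le_sum fun i _ ↦ hnm i
  have monotone_or_antitone : (∀ k, Monotone fun n : ι → ℕ ↦ (α : ℝ≥0∞) ^ (∑ i ∈ s k, n i)) ∨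
      ∀ k, Antitone fun n : ι → ℕ ↦ (α : ℝ≥0∞) ^ (∑ i ∈ s k, n i) := by
    rcases le_total α 1 with hα | hα
    · exact .inr fun k n m hnm ↦ pow_le_pow_right_of_le_one' (mod_cast hα) (monotone_sum k hnm)
    · exact .inl fun k n m hnm ↦ pow_le_pow_right' (mod_cast hα) (monotone_sum k hnm)
  have map_pow_sum (k : Fin M) :
      (Measure.pi fun i ↦ poissonMeasure (r i)).map (fun n ↦ (α : ℝ≥0∞) ^ (∑ i ∈ s k, n i)) =
        (poissonMeasure T).map fun m ↦ (α : ℝ≥0∞) ^ m := by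
    rw [← hs k, ← (hasLaw_sum_poissonMeasure r (s k)).map_eq,
      Measure.map_map .of_discrete .of_discrete]
    rfl
  refine (lintegral_iSup_pi_le _ (fun _ ↦ .of_discrete) monotone_or_antitone).trans_eq ?_
  simp_rw [map_pow_sum]
  rw [← Measure.pi_map_pi fun _ ↦ Measurable.of_discrete.aemeasurable,
    lintegral_map (.iSup measurable_pi_apply) .of_discrete]

theorem sum_pi_poissonMeasure_le [DecidableEq ι] (α : ℝ≥0) (r : ι → ℝ≥0) (T : ℝ≥0)
    (s : Fin M → Finset ι) (hs : ∀ k, ∑ i ∈ s k, r i = T) (A : Fin M → Set (ι → ℕ))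
    (hA : Pairwise fun j k ↦ Disjoint (A j) (A k)) :
    ∑ k, Measure.pi (fun i ↦ poissonMeasure ((if i ∈ s k then α else 1) * r i)) (A k) ≤
      optimalScore α T M := by
  have sum_filter (k : Fin M) : ∑ i with i ∈ s k, (r i : ℝ) = T := by
    rw [← hs k]; simp
  simp_rw [pi_poissonMeasure_ite_apply, sum_filter]
  rw [← Finset.mul_sum, optimalScore]
  gcongr
  calc ∑ k, ∫⁻ n in A k, (α : ℝ≥0∞) ^ (∑ i with i ∈ s k, n i)
        ∂Measure.pi (fun i ↦ poissonMeasure (r i))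
      ≤ ∑ k, ∫⁻ n in A k, ⨆ k : Fin M, (α : ℝ≥0∞) ^ (∑ i ∈ s k, n i)
        ∂Measure.pi (fun i ↦ poissonMeasure (r i)) := by
        refine Finset.sum_le_sum fun k _ ↦ lintegral_mono fun n ↦ ?_
        simpa using le_iSup (fun k ↦ (α : ℝ≥0∞) ^ (∑ i ∈ s k, n i)) k
    _ = ∫⁻ n in ⋃ k, A k, ⨆ k : Fin M, (α : ℝ≥0∞) ^ (∑ i ∈ s k, n i)
        ∂Measure.pi (fun i ↦ poissonMeasure (r i)) := by
        rw [lintegral_iUnion (fun _ ↦ .of_discrete) hA, tsum_fintype]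
    _ ≤ ∫⁻ n, ⨆ k : Fin M, (α : ℝ≥0∞) ^ (∑ i ∈ s k, n i)
        ∂Measure.pi (fun i ↦ poissonMeasure (r i)) := setLIntegral_le_lintegral _ _
    _ ≤ ∫⁻ z, ⨆ k : Fin M, (α : ℝ≥0∞) ^ z k ∂Measure.pi fun _ : Fin M ↦ poissonMeasure T :=
        lintegral_iSup_pow_sum_le α r T s hs

end Score

/-- The sets `s k` are padded by fresh coordinates to have total weight exactly `T`. -/
theorem sum_pi_poissonMeasure_sum_le {ι κ : Type*} [Finite ι] [DecidableEq ι] [Fintype κ] {M : ℕ}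
    (α T : ℝ≥0) (r : ι → ℝ≥0) (s : Fin M → Finset ι) (hs : ∀ k, ∑ i ∈ s k, r i ≤ T)
    {B : κ → Finset ι} (hB : Pairwise fun c d ↦ Disjoint (B c) (B d))
    (A : Fin M → Set (κ → ℕ)) (hA : Pairwise fun j k ↦ Disjoint (A j) (A k)) :
    ∑ k, Measure.pi (fun c ↦ poissonMeasure (∑ i ∈ B c, (if i ∈ s k then α else 1) * r i)) (A k) ≤
      optimalScore α T M := by
  cases nonempty_fintype ι
  let r' : ι ⊕ Fin M → ℝ≥0 := Sum.elim r fun k ↦ T - ∑ i ∈ s k, r i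
  let s' : Fin M → Finset (ι ⊕ Fin M) := fun k ↦ (s k).disjSum {k}
  let B' : κ → Finset (ι ⊕ Fin M) := fun c ↦ (B c).disjSum ∅
  let g : (ι ⊕ Fin M → ℕ) → κ → ℕ := fun n c ↦ ∑ i ∈ B' c, n i
  have hs' (k : Fin M) : ∑ i ∈ s' k, r' i = T := by
    rw [Finset.sum_disjSum, Finset.sum_singleton]
    exact add_tsub_cancel_of_le (hs k)
  have hB' : Pairwise fun c d ↦ Disjoint (B' c) (B' d) := fun c d h ↦ by
    simpa [B', Finset.disjSum_empty] using hB h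
  have pi_apply (k : Fin M) :
      Measure.pi (fun c ↦ poissonMeasure (∑ i ∈ B c, (if i ∈ s k then α else 1) * r i)) (A k) =
        Measure.pi (fun i ↦ poissonMeasure ((if i ∈ s' k then α else 1) * r' i)) (g ⁻¹' A k) := by
    rw [← Measure.map_apply .of_discrete .of_discrete, (hasLaw_sum_pi_poissonMeasure _ hB').map_eq]
    simp [B', s', r']
  simp_rw [pi_apply]
  exact sum_pi_poissonMeasure_le α r' T s' hs' _ fun j k h ↦ (hA h).preimage g

section PoissonPoints

variable {E : Type*} [MeasurableSpace E]

/-- The number of the points `u 0, …, u (N - 1)` in the set `A`, for `ω = (N, u)`. -/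
noncomputable def pointCount (A : Set E) (ω : ℕ × (ℕ → E)) : ℕ :=
  ∑ i ∈ Finset.range ω.1, A.indicator 1 (ω.2 i)

/-- The law of a Poisson point process with intensity measure `Λ`, encoded as a pair `(N, u)`:
a Poisson number `N` of points, which are the first `N` terms of a sequence `u` of independent
points with law `Λ / Λ E`. -/
noncomputable def pointProcessLaw [Nonempty E] (Λ : FiniteMeasure E) : Measure (ℕ × (ℕ → E)) :=
  (poissonMeasure Λ.mass).prod (Measure.infinitePi fun _ ↦ (Λ.normalize : Measure E))

instance [Nonempty E] (Λ : FiniteMeasure E) : IsProbabilityMeasure (pointProcessLaw Λ) := by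
  unfold pointProcessLaw
  infer_instance

theorem measurable_pointCount {A : Set E} (hA : MeasurableSet A) : Measurable (pointCount A) :=
  measurable_from_prod_countable_right fun n ↦ Finset.measurable_sum (Finset.range n) fun i _ ↦
    (measurable_one.indicator hA).comp (measurable_pi_apply i)

theorem integral_prod_range_infinitePi {μ : Measure E} [IsProbabilityMeasure μ] {w : E → ℂ}
    (hw : Measurable w) (n : ℕ) :
    ∫ u, ∏ i ∈ Finset.range n, w (u i) ∂Measure.infinitePi (fun _ : ℕ ↦ μ) =
      (∫ e, w e ∂μ) ^ n := by
  have restrict (u : ℕ → E) : ∏ i ∈ Finset.range n, w (u i) =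
      (fun v : Finset.range n → E ↦ ∏ i, w (v i)) ((Finset.range n).restrict u) :=
    (Finset.prod_coe_sort (Finset.range n) fun i ↦ w (u i)).symm
  calc ∫ u, ∏ i ∈ Finset.range n, w (u i) ∂Measure.infinitePi (fun _ : ℕ ↦ μ)
      = ∫ v, ∏ i, w (v i) ∂Measure.pi (fun _ : Finset.range n ↦ μ) := by
        rw [integral_congr_ae (.of_forall restrict)]
        exact integral_restrict_infinitePi (μ := fun _ : ℕ ↦ μ) (Measurable.aestronglyMeasurable
          (Finset.measurable_prod _ fun i _ ↦ hw.comp (measurable_pi_apply i)))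
    _ = (∫ e, w e ∂μ) ^ n := by
        rw [integral_fintype_prod_eq_prod fun _ : Finset.range n ↦ w]
        simp

theorem integral_prod_pow_indicator {κ : Type*} [Fintype κ] {μ : Measure E}
    [IsProbabilityMeasure μ] {A : κ → Set E} (hAm : ∀ c, MeasurableSet (A c))
    (hA : Pairwise fun c d ↦ Disjoint (A c) (A d)) (z : κ → ℂ) :
    ∫ e, ∏ c, z c ^ (A c).indicator (1 : E → ℕ) e ∂μ = 1 + ∑ c, μ.real (A c) * (z c - 1) := by
  have integrable_indicator (c : κ) : Integrable ((A c).indicator fun _ ↦ z c - 1) μ :=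
    (integrable_const _).indicator (hAm c)
  simp_rw [prod_pow_indicator_eq hA]
  rw [integral_add (integrable_const _) (integrable_finsetSum _ fun c _ ↦ integrable_indicator c),
    integral_finsetSum _ fun c _ ↦ integrable_indicator c]
  simp [integral_indicator_const, hAm]

/-- **Complete randomness** of the Poisson point process. -/
theorem hasLaw_pointCount [Nonempty E] {κ : Type*} [Fintype κ] (Λ : FiniteMeasure E)
    {A : κ → Set E} (hAm : ∀ c, MeasurableSet (A c))
    (hA : Pairwise fun c d ↦ Disjoint (A c) (A d)) :
    HasLaw (fun ω c ↦ pointCount (A c) ω) (Measure.pi fun c ↦ poissonMeasure (Λ (A c)))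
      (pointProcessLaw Λ) := by
  have measurable_counts : Measurable fun (ω : ℕ × (ℕ → E)) c ↦ pointCount (A c) ω :=
    measurable_pi_lambda _ fun c ↦ measurable_pointCount (hAm c)
  refine hasLaw_pi_poissonMeasure_of_integral_prod_pow measurable_counts _ fun z hz ↦ ?_
  let w : E → ℂ := fun e ↦ ∏ c, z c ^ (A c).indicator (1 : E → ℕ) e
  have measurable_w : Measurable w := Finset.measurable_prod _ fun c _ ↦
    Measurable.of_discrete.comp (measurable_one.indicator (hAm c))
  have prod_pow_pointCount (ω : ℕ × (ℕ → E)) :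
      ∏ c, z c ^ pointCount (A c) ω = ∏ i ∈ Finset.range ω.1, w (ω.2 i) := by
    simp_rw [pointCount, ← Finset.prod_pow_eq_pow_sum]
    exact Finset.prod_comm
  have integrable_prod : Integrable (fun ω : ℕ × (ℕ → E) ↦ ∏ c, z c ^ pointCount (A c) ω)
      (pointProcessLaw Λ) := by
    refine .of_bound (Measurable.of_discrete (f := fun n : κ → ℕ ↦ ∏ c, z c ^ n c) |>.comp
      measurable_counts).aestronglyMeasurable 1 (.of_forall fun ω ↦ ?_)
    simp [norm_prod, hz]
  have mass_mul_integral : Λ.mass * (∫ e, w e ∂Λ.normalize - 1) = ∑ c, Λ (A c) * (z c - 1) := by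
    rw [integral_prod_pow_indicator hAm hA, add_sub_cancel_left, Finset.mul_sum]
    simp_rw [Λ.self_eq_mass_mul_normalize, NNReal.coe_mul, Complex.ofReal_mul, mul_assoc]
    rfl
  rw [pointProcessLaw, integral_prod _ integrable_prod]
  simp_rw [prod_pow_pointCount, integral_prod_range_infinitePi measurable_w,
    integral_pow_poissonMeasure]
  rw [mass_mul_integral]

end PoissonPoints

section Increments

variable {T : ℝ≥0}

theorem pairwise_disjoint_Ioc_castSucc_succ {β : Type*} [Preorder β] {n : ℕ} {t : Fin (n + 1) → β}
    (ht : Monotone t) :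
    Pairwise fun i j : Fin n ↦
      Disjoint (Set.Ioc (t i.castSucc) (t i.succ)) (Set.Ioc (t j.castSucc) (t j.succ)) := by
  refine (pairwise_disjoint_on _).2 fun i j hij ↦ ?_
  exact Set.Ioc_disjoint_Ioc_of_le (ht (Fin.le_castSucc_iff.2 (by simpa using hij)))

/-- The increments of a path over the intervals of the grid `t`. -/
def pathIncrements {n : ℕ} (t : Fin (n + 1) → Time T) (w : CountingPath T) : Fin n → ℕ :=
  fun j ↦ w.1 (t j.succ) - w.1 (t j.castSucc)

theorem measurable_path_eval (t : Time T) : Measurable fun w : CountingPath T ↦ w.1 t :=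
  (measurable_pi_apply t).comp measurable_subtype_coe

theorem measurable_pathIncrements {n : ℕ} (t : Fin (n + 1) → Time T) :
    Measurable (pathIncrements t) :=
  measurable_pi_lambda _ fun _ ↦ (Measurable.of_discrete (f := fun p : ℕ × ℕ ↦ p.1 - p.2)).comp
    ((measurable_path_eval _).prodMk (measurable_path_eval _))

theorem path_eval_eq_of_pathIncrements_eq {n : ℕ} {t : Fin (n + 1) → Time T}
    (ht : Monotone t) (ht0 : t 0 = Time.start T) {w w' : CountingPath T}
    (h : pathIncrements t w = pathIncrements t w') (j : Fin (n + 1)) : w.1 (t j) = w'.1 (t j) := by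
  induction j using Fin.induction with
  | zero => rw [ht0, w.2.1, w'.2.1]
  | succ j ih =>
    have increment_eq : w.1 (t j.succ) - w.1 (t j.castSucc) =
      w'.1 (t j.succ) - w'.1 (t j.castSucc) := congrFun h j
    have le_succ := w.2.2.1 (ht j.castSucc_lt_succ.le)
    have le_succ' := w'.2.2.1 (ht j.castSucc_lt_succ.le)
    omega

end Increments

section Intensity

variable {L : ℕ∞} {T : ℝ≥0}

/-- Lebesgue measure on `[0, T]`. -/
noncomputable abbrev timeVolume (T : ℝ≥0) : Measure (Time T) := Measure.comap Subtype.val volume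

theorem timeVolume_apply (s : Set (Time T)) : timeVolume T s = volume (Subtype.val '' s) :=
  (MeasurableEmbedding.subtype_coe measurableSet_Icc).comap_apply _ _

theorem timeVolume_univ (T : ℝ≥0) : timeVolume T Set.univ = T := by
  rw [timeVolume_apply, Set.image_univ, Subtype.range_coe, Real.volume_Icc, sub_zero,
    ENNReal.ofReal_coe_nnreal]

instance (T : ℝ≥0) : IsFiniteMeasure (timeVolume T) := ⟨by simp [timeVolume_univ]⟩

theorem intensity_eq_ite (α : ℝ≥0) (x : Time T → Band L) (i : Band L) (τ : Time T) :
    intensity α x i τ = (if x τ = i then α else 1 : ℝ≥0) := by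
  by_cases h : x τ = i <;> simp [intensity, h]

/-- The intensity measure of the point process of band `i` for the input `x`: its density is
`intensity α x i`, written as an `ℝ≥0`-valued function. -/
noncomputable def intensityMeasure (α : ℝ≥0) (x : Time T → Band L) (i : Band L) :
    FiniteMeasure (Time T) :=
  ⟨(timeVolume T).withDensity fun τ ↦ (if x τ = i then α else 1 : ℝ≥0), by
    refine isFiniteMeasure_withDensity (ne_top_of_le_ne_top (b := ∫⁻ _, max α 1 ∂timeVolume T) ?_
      (lintegral_mono fun τ ↦ ?_))
    · rw [lintegral_const]
      finiteness
    · split_ifs <;> simp⟩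

theorem intensityMeasure_apply (α : ℝ≥0) (x : Time T → Band L) (i : Band L) {s : Set (Time T)}
    (hs : MeasurableSet s) :
    intensityMeasure α x i s =
      (∫⁻ τ in s, (if x τ = i then α else 1 : ℝ≥0) ∂timeVolume T).toNNReal :=
  congrArg ENNReal.toNNReal (withDensity_apply _ hs)

theorem toNNReal_setIntegral_intensity (α : ℝ≥0) {x : Time T → Band L} (hx : Measurable x)
    (i : Band L) {s : Set (Time T)} (hs : MeasurableSet s) :
    (∫ τ in s, intensity α x i τ ∂timeVolume T).toNNReal = intensityMeasure α x i s := by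
  have measurable_weight : Measurable fun τ ↦ (if x τ = i then α else 1 : ℝ≥0) :=
    Measurable.ite (hx (measurableSet_singleton i)) measurable_const measurable_const
  simp_rw [intensityMeasure_apply α x i hs, intensity_eq_ite]
  rw [lintegral_coe_eq_integral]
  · rfl
  · refine .of_bound measurable_weight.coe_nnreal_real.aestronglyMeasurable (max α 1 : ℝ≥0)
      (.of_forall fun τ ↦ ?_)
    split_ifs <;> simp

end Intensity

section OutputLaw

variable {L : ℕ∞} {T : ℝ≥0}

instance (T : ℝ≥0) : Nonempty (Time T) := ⟨Time.start T⟩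

theorem monotone_pointCount_Ioc {β : Type*} [Preorder β] (a : β) (ω : ℕ × (ℕ → β)) :
    Monotone fun t ↦ pointCount (Set.Ioc a t) ω := fun _ _ hst ↦
  Finset.sum_le_sum fun _ _ ↦ Set.indicator_le_indicator_of_subset (Set.Ioc_subset_Ioc_right hst)
    (fun _ ↦ Nat.zero_le _) _

theorem continuousWithinAt_pointCount_Ioc {β : Type*} [LinearOrder β] [TopologicalSpace β]
    [ClosedIciTopology β] (a : β) (ω : ℕ × (ℕ → β)) (t : β) :
    ContinuousWithinAt (fun t ↦ pointCount (Set.Ioc a t) ω) (Set.Ici t) t := by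
  refine tendsto_finsetSum _ fun i _ ↦ tendsto_nhds_of_eventually_eq ?_
  by_cases hi : ω.2 i ≤ t
  · filter_upwards [self_mem_nhdsWithin] with s hs
    simp [Set.indicator_apply, hi, hi.trans hs]
  · filter_upwards [mem_nhdsWithin_of_mem_nhds (Iio_mem_nhds (not_le.1 hi))] with s hs
    simp [hi, not_le.2 hs]

/-- The path that counts the points of the configuration `ω` of `pointCount` in time. -/
noncomputable def countingPath (ω : ℕ × (ℕ → Time T)) : CountingPath T :=
  ⟨fun t ↦ pointCount (Set.Ioc (Time.start T) t) ω, by simp [pointCount],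
    monotone_pointCount_Ioc _ ω, continuousWithinAt_pointCount_Ioc _ ω⟩

theorem measurable_countingPath : Measurable (countingPath (T := T)) :=
  Measurable.subtype_mk (measurable_pi_lambda _ fun _ ↦ measurable_pointCount measurableSet_Ioc)

theorem pathIncrements_countingPath {n : ℕ} {t : Fin (n + 1) → Time T} (ht : Monotone t)
    (ω : ℕ × (ℕ → Time T)) (j : Fin n) :
    pathIncrements t (countingPath ω) j =
      pointCount (Set.Ioc (t j.castSucc) (t j.succ)) ω := by
  have htj : t j.castSucc ≤ t j.succ := ht j.castSucc_lt_succ.le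
  have h0 : Time.start T ≤ t j.castSucc := (t j.castSucc).2.1
  rw [pathIncrements, Nat.sub_eq_iff_eq_add' ((countingPath ω).2.2.1 htj)]
  simp only [countingPath, pointCount]
  rw [← Finset.sum_add_distrib]
  refine Finset.sum_congr rfl fun i _ ↦ ?_
  rw [← Set.Ioc_union_Ioc_eq_Ioc h0 htj,
    Set.indicator_union_of_disjoint (Set.Ioc_disjoint_Ioc_of_le le_rfl)]

/-- The law of the counting path of a Poisson process with intensity measure `Λ`. -/
noncomputable def poissonPathLaw (Λ : FiniteMeasure (Time T)) : Measure (CountingPath T) :=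
  (pointProcessLaw Λ).map countingPath

instance (Λ : FiniteMeasure (Time T)) : IsProbabilityMeasure (poissonPathLaw Λ) :=
  Measure.isProbabilityMeasure_map measurable_countingPath.aemeasurable

theorem hasLaw_pathIncrements_poissonPathLaw (Λ : FiniteMeasure (Time T)) {n : ℕ}
    {t : Fin (n + 1) → Time T} (ht : Monotone t) :
    HasLaw (pathIncrements t)
      (Measure.pi fun j : Fin n ↦ poissonMeasure (Λ (Set.Ioc (t j.castSucc) (t j.succ))))
      (poissonPathLaw Λ) := by
  refine ⟨(measurable_pathIncrements t).aemeasurable, ?_⟩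
  rw [poissonPathLaw, Measure.map_map (measurable_pathIncrements t) measurable_countingPath,
    ← (hasLaw_pointCount Λ (fun _ ↦ measurableSet_Ioc)
      (pairwise_disjoint_Ioc_castSucc_succ ht)).map_eq]
  congr 1 with ω j
  exact pathIncrements_countingPath ht ω j

/-- The law of independent Poisson processes with the intensities that the input `x` imposes on
the bands. -/
noncomputable def outputLaw (α : ℝ≥0) (x : Time T → Band L) : Measure (Output L T) :=
  Measure.infinitePi fun i ↦ poissonPathLaw (intensityMeasure α x i)

instance (α : ℝ≥0) (x : Time T → Band L) : IsProbabilityMeasure (outputLaw α x) := by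
  unfold outputLaw
  infer_instance

theorem isOutputLaw_outputLaw (α : ℝ≥0) {x : Time T → Band L} (hx : Measurable x) :
    IsOutputLaw α x (outputLaw α x) := by
  have hasLaw_increments (i : Band L) {n : ℕ} {t : Fin (n + 1) → Time T} (ht : Monotone t) :
      HasLaw (fun y : Output L T ↦ pathIncrements t (y i)) (Measure.pi fun j : Fin n ↦
        poissonMeasure (intensityMeasure α x i (Set.Ioc (t j.castSucc) (t j.succ))))
        (outputLaw α x) :=
    (hasLaw_pathIncrements_poissonPathLaw _ ht).fun_comp
      (measurePreserving_eval_infinitePi (fun i ↦ poissonPathLaw (intensityMeasure α x i)) i).hasLaw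
  have hasLaw_increment (i : Band L) {n : ℕ} {t : Fin (n + 1) → Time T} (ht : Monotone t)
      (j : Fin n) :
      HasLaw (fun y : Output L T ↦ pathIncrements t (y i) j)
        (poissonMeasure (intensityMeasure α x i (Set.Ioc (t j.castSucc) (t j.succ))))
        (outputLaw α x) :=
    (measurePreserving_eval (fun j : Fin n ↦ poissonMeasure
      (intensityMeasure α x i (Set.Ioc (t j.castSucc) (t j.succ)))) j).hasLaw.fun_comp
        (hasLaw_increments i ht)
  refine ⟨inferInstance, iIndepFun_infinitePi (X := fun _ w ↦ w) fun _ ↦ measurable_id, ?_, ?_⟩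
  · intro i n t ht
    exact (iIndepFun_iff_hasLaw_pi_pi (hasLaw_increment i ht)).2 (hasLaw_increments i ht)
  · intro i s t hst
    rw [toNNReal_setIntegral_intensity α hx i measurableSet_Ioc]
    have monotone_pair : Monotone ![s, t] := by simpa using hst.le
    exact hasLaw_increment i monotone_pair 0

end OutputLaw

section Approximation

variable {Ω ι : Type*} [Fintype ι]

theorem subset_sdiff_biUnion_union_iUnion_symmDiff [DecidableEq ι] {A : ι → Set Ω}
    (hA : Pairwise fun j k ↦ Disjoint (A j) (A k)) (B : ι → Set Ω) (k : ι) :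
    A k ⊆ (B k \ ⋃ j ∈ Finset.univ.erase k, B j) ∪ ⋃ j, symmDiff (B j) (A j) := by
  intro ω hω
  by_cases hB : ω ∈ B k \ ⋃ j ∈ Finset.univ.erase k, B j
  · exact .inl hB
  refine .inr (Set.mem_iUnion.2 ?_)
  by_cases hωk : ω ∈ B k
  · obtain ⟨j, hjk, hωj⟩ : ∃ j, j ≠ k ∧ ω ∈ B j := by simpa [hωk] using hB
    exact ⟨j, .inl ⟨hωj, fun h ↦ Set.disjoint_left.1 (hA hjk) h hω⟩⟩
  · exact ⟨k, .inr ⟨hω, hωk⟩⟩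

theorem measure_le_measure_sdiff_biUnion_add [DecidableEq ι] [MeasurableSpace Ω] (μ : Measure Ω)
    {A : ι → Set Ω} (hA : Pairwise fun j k ↦ Disjoint (A j) (A k)) (B : ι → Set Ω) (k : ι) :
    μ (A k) ≤ μ (B k \ ⋃ j ∈ Finset.univ.erase k, B j) + ∑ j, μ (symmDiff (B j) (A j)) :=
  calc μ (A k)
      ≤ μ ((B k \ ⋃ j ∈ Finset.univ.erase k, B j) ∪ ⋃ j, symmDiff (B j) (A j)) :=
        measure_mono (subset_sdiff_biUnion_union_iUnion_symmDiff hA B k)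
    _ ≤ μ (B k \ ⋃ j ∈ Finset.univ.erase k, B j) + μ (⋃ j, symmDiff (B j) (A j)) :=
        measure_union_le _ _
    _ ≤ μ (B k \ ⋃ j ∈ Finset.univ.erase k, B j) + ∑ j, μ (symmDiff (B j) (A j)) := by
        gcongr
        exact measure_iUnion_fintype_le _ _

theorem pairwise_disjoint_sdiff_biUnion [DecidableEq ι] (B : ι → Set Ω) :
    Pairwise fun j k ↦ Disjoint (B j \ ⋃ i ∈ Finset.univ.erase j, B i)
      (B k \ ⋃ i ∈ Finset.univ.erase k, B i) := fun j k hjk ↦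
  Set.disjoint_left.2 fun _ hωj hωk ↦ hωk.2 (Set.mem_biUnion (by simpa using hjk) hωj.1)

theorem sum_measure_le_of_generateFrom_isSetRing [mΩ : MeasurableSpace Ω] {P : ι → Measure Ω}
    [∀ k, IsFiniteMeasure (P k)] {C : Set (Set Ω)} (hC : IsSetRing C) (hCuniv : Set.univ ∈ C)
    (hgen : mΩ = MeasurableSpace.generateFrom C) {b : ℝ≥0∞}
    (hb : ∀ B : ι → Set Ω, (∀ k, B k ∈ C) → (Pairwise fun j k ↦ Disjoint (B j) (B k)) →
      ∑ k, P k (B k) ≤ b)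
    {A : ι → Set Ω} (hAm : ∀ k, MeasurableSet (A k))
    (hA : Pairwise fun j k ↦ Disjoint (A j) (A k)) :
    ∑ k, P k (A k) ≤ b := by
  classical
  refine ENNReal.le_of_forall_pos_le_add fun ε hε _ ↦ ?_
  obtain ⟨δ, hδ, hδε⟩ := ENNReal.exists_nnreal_pos_mul_lt
    (a := Fintype.card ι * Fintype.card ι) (by finiteness) (ENNReal.coe_ne_zero.2 hε.ne')
  have approx (k : ι) : ∃ B ∈ C, (∑ i, P i) (symmDiff B (A k)) < δ :=
    exists_measure_symmDiff_lt_of_generateFrom_isSetRing hC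
      ⟨{Set.univ}, Set.countable_singleton _, by simpa using hCuniv, by simp⟩ hgen (hAm k)
      (ENNReal.coe_pos.2 hδ)
  choose B hB hBA using approx
  have measure_symmDiff_le (k j : ι) : P k (symmDiff (B j) (A j)) ≤ δ := by
    refine le_trans ?_ (hBA j).le
    rw [Measure.finsetSum_apply]
    exact Finset.single_le_sum (f := fun i ↦ P i (symmDiff (B j) (A j))) (fun _ _ ↦ zero_le)
      (Finset.mem_univ k)
  calc ∑ k, P k (A k)
      ≤ ∑ k, (P k (B k \ ⋃ j ∈ Finset.univ.erase k, B j) + ∑ _j : ι, (δ : ℝ≥0∞)) := by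
        gcongr with k
        refine (measure_le_measure_sdiff_biUnion_add (P k) hA B k).trans ?_
        gcongr
        exact measure_symmDiff_le k _
    _ = ∑ k, P k (B k \ ⋃ j ∈ Finset.univ.erase k, B j) +
          δ * (Fintype.card ι * Fintype.card ι) := by
        simp only [Finset.sum_add_distrib, Finset.sum_const, Finset.card_univ, nsmul_eq_mul]
        ring
    _ ≤ b + ε := by
        gcongr
        exact hb _ (fun k ↦ hC.sdiff_mem (hB k) (hC.biUnion_mem _ fun j _ ↦ hB j))
          (pairwise_disjoint_sdiff_biUnion B)

end Approximation

section FiniteDimensionalEvents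

variable (L : ℕ∞) (T : ℝ≥0)

/-- The values of the output in all bands at all times, as a point of a product space. -/
def outputValues (y : Output L T) : Band L × Time T → ℕ := fun p ↦ (y p.1).1 p.2

/-- The events that depend on the values of the output in finitely many bands at finitely many
times, by which the events of the output space are approximated. -/
def finiteDimensionalEvents : Set (Set (Output L T)) :=
  (outputValues L T ⁻¹' ·) '' measurableCylinders fun _ ↦ ℕ

theorem isSetRing_finiteDimensionalEvents : IsSetRing (finiteDimensionalEvents L T) where
  empty_mem := ⟨∅, isSetRing_measurableCylinders.empty_mem, rfl⟩
  union_mem := by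
    rintro _ _ ⟨A, hA, rfl⟩ ⟨B, hB, rfl⟩
    exact ⟨A ∪ B, isSetRing_measurableCylinders.union_mem hA hB, rfl⟩
  sdiff_mem := by
    rintro _ _ ⟨A, hA, rfl⟩ ⟨B, hB, rfl⟩
    exact ⟨A \ B, isSetRing_measurableCylinders.sdiff_mem hA hB, rfl⟩

theorem univ_mem_finiteDimensionalEvents : Set.univ ∈ finiteDimensionalEvents L T :=
  ⟨Set.univ, univ_mem_measurableCylinders _, rfl⟩

theorem generateFrom_finiteDimensionalEvents :
    (inferInstance : MeasurableSpace (Output L T)) =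
      MeasurableSpace.generateFrom (finiteDimensionalEvents L T) := by
  have comap_outputValues : (inferInstance : MeasurableSpace (Output L T)) =
      MeasurableSpace.comap (outputValues L T) MeasurableSpace.pi := by
    simp only [MeasurableSpace.pi, MeasurableSpace.comap_iSup, MeasurableSpace.comap_comp,
      iSup_prod, inferInstance, Subtype.instMeasurableSpace]
    rfl
  rw [comap_outputValues, ← generateFrom_measurableCylinders,
    MeasurableSpace.comap_generateFrom]
  rfl

variable {L T}

theorem exists_finset_determining {ι : Type*} [Finite ι] {A : ι → Set (Output L T)}
    (hA : ∀ k, A k ∈ finiteDimensionalEvents L T) :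
    ∃ s : Finset (Band L × Time T), ∀ y y' : Output L T,
      Set.EqOn (outputValues L T y) (outputValues L T y') s → ∀ k, y ∈ A k → y' ∈ A k := by
  classical
  cases nonempty_fintype ι
  choose C hC hCA using hA
  choose s S _ hs using fun k ↦ (mem_measurableCylinders _).1 (hC k)
  refine ⟨Finset.univ.biUnion s, fun y y' h k hy ↦ ?_⟩
  have restrict_eq : (s k).restrict (outputValues L T y) =
      (s k).restrict (outputValues L T y') :=
    funext fun p ↦ h (Finset.mem_biUnion.2 ⟨k, Finset.mem_univ k, p.2⟩)
  rw [← hCA k, hs k] at hy ⊢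
  simpa only [Set.mem_preimage, mem_cylinder, restrict_eq] using hy

end FiniteDimensionalEvents

section Converse

variable {L : ℕ∞} {T : ℝ≥0}

/-- The increments of the outputs of the bands in `F` over the intervals of the grid `t`. -/
def increments {n : ℕ} (F : Finset (Band L)) (t : Fin (n + 1) → Time T) (y : Output L T) :
    F × Fin n → ℕ :=
  fun p ↦ pathIncrements t (y p.1) p.2

theorem hasLaw_increments {α : ℝ≥0} {x : Time T → Band L} (hx : Measurable x)
    {P : Measure (Output L T)} (hP : IsOutputLaw α x P) {n : ℕ} (F : Finset (Band L))
    {t : Fin (n + 1) → Time T} (ht : StrictMono t) :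
    HasLaw (increments F t) (Measure.pi fun p : F × Fin n ↦ poissonMeasure
      (intensityMeasure α x p.1 (Set.Ioc (t p.2.castSucc) (t p.2.succ)))) P := by
  refine iIndepFun.hasLaw_pi (X := fun p y ↦ increments F t y p) (fun p ↦ ?_) ?_
  · rw [← toNNReal_setIntegral_intensity α hx p.1 measurableSet_Ioc]
    exact hP.law_increment p.1 _ _ (ht p.2.castSucc_lt_succ)
  · exact iIndepFun_uncurry'
      (X := fun (i : F) (j : Fin n) (y : Output L T) ↦ pathIncrements t (y i) j)
      (fun i j ↦ (measurable_pi_apply j).comp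
        ((measurable_pathIncrements t).comp (measurable_pi_apply i.1)))
      ((hP.indep_bands.precomp Subtype.val_injective).comp (fun _ ↦ pathIncrements t)
        fun _ ↦ measurable_pathIncrements t)
      fun i ↦ hP.indep_increments i n t ht.monotone

theorem exists_strictMono_range_eq {β : Type*} [LinearOrder β] {G : Finset β} (hG : G.Nonempty) :
    ∃ (n : ℕ) (t : Fin (n + 1) → β), StrictMono t ∧ Set.range t = G := by
  have hcard : G.card = G.card - 1 + 1 := (Nat.sub_add_cancel hG.card_pos).symm
  exact ⟨G.card - 1, G.orderEmbOfFin hcard, (G.orderEmbOfFin hcard).strictMono,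
    G.range_orderEmbOfFin hcard⟩

theorem exists_increments_determining (s : Finset (Band L × Time T)) :
    ∃ (n : ℕ) (F : Finset (Band L)) (t : Fin (n + 1) → Time T), StrictMono t ∧
      ∀ y y' : Output L T, increments F t y = increments F t y' →
        Set.EqOn (outputValues L T y) (outputValues L T y') s := by
  classical
  obtain ⟨n, t, ht, hrange⟩ := exists_strictMono_range_eq
    (Finset.insert_nonempty (Time.start T) (s.image Prod.snd))
  have mem_range {τ : Time T} (hτ : τ ∈ insert (Time.start T) (s.image Prod.snd)) :
      ∃ j, t j = τ := by
    rwa [← Finset.mem_coe, ← hrange] at hτ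
  have zero_eq_start : t 0 = Time.start T := by
    obtain ⟨j, hj⟩ := mem_range (Finset.mem_insert_self _ _)
    exact le_antisymm (hj ▸ ht.monotone (Fin.zero_le j)) (t 0).2.1
  refine ⟨n, s.image Prod.fst, t, ht, fun y y' h p hp ↦ ?_⟩
  obtain ⟨j, hj⟩ := mem_range (Finset.mem_insert_of_mem (Finset.mem_image_of_mem Prod.snd hp))
  have pathIncrements_eq : pathIncrements t (y p.1) = pathIncrements t (y' p.1) :=
    funext fun i ↦ congrFun h (⟨p.1, Finset.mem_image_of_mem Prod.fst hp⟩, i)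
  rw [outputValues, outputValues, ← hj]
  exact path_eval_eq_of_pathIncrements_eq ht.monotone zero_eq_start pathIncrements_eq j

variable {M : ℕ}

/-- The set of the messages that occupy band `i` at time `τ`. The times at which it takes a given
value form the pieces of `[0, T]` on which all the messages have constant intensity in band `i`. -/
def occupants (x : Fin M → Time T → Band L) (i : Band L) (τ : Time T) : Finset (Fin M) :=
  {k | x k τ = i}

theorem mem_occupants {x : Fin M → Time T → Band L} {i : Band L} {τ : Time T} {k : Fin M} :
    k ∈ occupants x i τ ↔ x k τ = i := by
  simp [occupants]

theorem measurable_occupants {x : Fin M → Time T → Band L} (hx : ∀ k, Measurable (x k))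
    (i : Band L) : Measurable[_, ⊤] (occupants x i) := by
  let : MeasurableSpace (Finset (Fin M)) := ⊤
  refine measurable_to_countable' fun S ↦ ?_
  have preimage_eq : occupants x i ⁻¹' {S} = ⋂ k, {τ | x k τ = i ↔ k ∈ S} := by
    ext τ
    simp [Finset.ext_iff, mem_occupants]
  rw [preimage_eq]
  refine .iInter fun k ↦ ?_
  by_cases hk : k ∈ S
  · simp only [hk, iff_true]
    exact hx k (measurableSet_singleton i)
  · simp only [hk, iff_false]
    exact (hx k (measurableSet_singleton i)).compl

theorem intensityMeasure_eq_sum_occupants {x : Fin M → Time T → Band L}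
    (hx : ∀ k, Measurable (x k)) (α : ℝ≥0) (k : Fin M) (i : Band L) {s : Set (Time T)}
    (hs : MeasurableSet s) :
    intensityMeasure α (x k) i s = ∑ S, (if k ∈ S then α else 1) *
      (timeVolume T (occupants x i ⁻¹' {S} ∩ s)).toNNReal := by
  let : MeasurableSpace (Finset (Fin M)) := ⊤
  have hm := measurable_occupants hx i
  rw [intensityMeasure_apply α (x k) i hs]
  simp_rw [← mem_occupants (k := k)]
  rw [← lintegral_map (f := fun S ↦ ((if k ∈ S then α else 1 : ℝ≥0) : ℝ≥0∞)) .of_discrete hm,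
    lintegral_fintype, ENNReal.toNNReal_sum fun S _ ↦ by finiteness]
  refine Finset.sum_congr rfl fun S _ ↦ ?_
  rw [Measure.map_apply hm .of_discrete, Measure.restrict_apply (hm .of_discrete),
    ENNReal.toNNReal_mul, ENNReal.toNNReal_coe]

theorem sum_timeVolume_occupants_le {x : Fin M → Time T → Band L} (hx : ∀ k, Measurable (x k))
    {n : ℕ} (F : Finset (Band L)) {t : Fin (n + 1) → Time T} (ht : Monotone t) (k : Fin M) :
    ∑ p : (F × Fin n) × Finset (Fin M) with k ∈ p.2, (timeVolume T (occupants x p.1.1 ⁻¹' {p.2} ∩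
      Set.Ioc (t p.1.2.castSucc) (t p.1.2.succ))).toNNReal ≤ T := by
  rw [← ENNReal.coe_le_coe, ENNReal.ofNNReal_finsetSum, ← timeVolume_univ]
  simp_rw [ENNReal.coe_toNNReal (measure_ne_top _ _)]
  refine sum_measure_le_measure_univ (fun p _ ↦ ((measurable_occupants hx _ trivial).inter
    measurableSet_Ioc).nullMeasurableSet) fun p hp q hq hpq ↦ Disjoint.aedisjoint ?_
  refine Set.disjoint_left.2 fun τ hτp hτq ↦ hpq ?_
  have input_eq {p : (F × Fin n) × Finset (Fin M)} (hkp : k ∈ p.2)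
      (hτ : occupants x p.1.1 τ = p.2) : x k τ = p.1.1 :=
    mem_occupants.1 (hτ ▸ hkp)
  have band_eq : p.1.1 = q.1.1 := Subtype.ext
    ((input_eq (by simpa using hp) hτp.1).symm.trans (input_eq (by simpa using hq) hτq.1))
  have interval_eq : p.1.2 = q.1.2 := by
    by_contra hne
    exact Set.disjoint_left.1 (pairwise_disjoint_Ioc_castSucc_succ ht hne) hτp.2 hτq.2
  have occupants_eq : p.2 = q.2 := by
    rw [← show occupants x p.1.1 τ = p.2 from hτp.1, band_eq]
    exact hτq.1
  exact Prod.ext (Prod.ext band_eq interval_eq) occupants_eq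

variable {α : ℝ≥0} {x : Fin M → Time T → Band L} {P : Fin M → Measure (Output L T)}

theorem sum_measure_le_of_mem_finiteDimensionalEvents (hx : ∀ k, Measurable (x k))
    (hP : ∀ k, IsOutputLaw α (x k) (P k)) {A : Fin M → Set (Output L T)}
    (hAf : ∀ k, A k ∈ finiteDimensionalEvents L T)
    (hA : Pairwise fun j k ↦ Disjoint (A j) (A k)) :
    ∑ k, P k (A k) ≤ optimalScore α T M := by
  obtain ⟨s, hs⟩ := exists_finset_determining hAf
  obtain ⟨n, F, t, ht, heqOn⟩ := exists_increments_determining s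
  let ν : (F × Fin n) × Finset (Fin M) → ℝ≥0 := fun p ↦ (timeVolume T
    (occupants x p.1.1 ⁻¹' {p.2} ∩ Set.Ioc (t p.1.2.castSucc) (t p.1.2.succ))).toNNReal
  let B : F × Fin n → Finset ((F × Fin n) × Finset (Fin M)) := fun c ↦ {c} ×ˢ Finset.univ
  have preimage_image (k : Fin M) : increments F t ⁻¹' (increments F t '' A k) = A k := by
    refine Set.Subset.antisymm ?_ (Set.subset_preimage_image _ _)
    rintro y ⟨y', hy', h⟩
    exact hs y' y (heqOn y' y h) k hy'
  have disjoint_B : Pairwise fun c d ↦ Disjoint (B c) (B d) := fun c d hcd ↦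
    Finset.disjoint_product.2 (.inl (by simpa using hcd))
  have disjoint_image : Pairwise fun j k ↦
      Disjoint (increments F t '' A j) (increments F t '' A k) := fun j k hjk ↦
    Set.disjoint_image_left.2 (by rw [preimage_image]; exact hA hjk)
  have measure_eq (k : Fin M) : P k (A k) = Measure.pi (fun c ↦ poissonMeasure
      (∑ p ∈ B c, (if p ∈ ({p | k ∈ p.2} : Finset _) then α else 1) * ν p))
      (increments F t '' A k) := by
    have hlaw := hasLaw_increments (hx k) (hP k) F ht
    simp_rw [intensityMeasure_eq_sum_occupants hx α k _ measurableSet_Ioc] at hlaw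
    conv_lhs => rw [← preimage_image k]
    rw [← Measure.map_apply_of_aemeasurable hlaw.aemeasurable .of_discrete, hlaw.map_eq]
    simp [B, ν]
  simp_rw [measure_eq]
  exact sum_pi_poissonMeasure_sum_le α T ν _ (sum_timeVolume_occupants_le hx F ht.monotone)
    disjoint_B _ disjoint_image

theorem sum_measure_le_optimalScore (hx : ∀ k, Measurable (x k))
    (hP : ∀ k, IsOutputLaw α (x k) (P k)) {A : Fin M → Set (Output L T)}
    (hAm : ∀ k, MeasurableSet (A k)) (hA : Pairwise fun j k ↦ Disjoint (A j) (A k)) :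
    ∑ k, P k (A k) ≤ optimalScore α T M :=
  have := fun k ↦ (hP k).isProbabilityMeasure
  sum_measure_le_of_generateFrom_isSetRing (isSetRing_finiteDimensionalEvents L T)
    (univ_mem_finiteDimensionalEvents L T) (generateFrom_finiteDimensionalEvents L T)
    (fun _ ↦ sum_measure_le_of_mem_finiteDimensionalEvents hx hP) hAm hA

end Converse

section OwnBand

variable {M : ℕ}

/-- The law of the total counts of `M` bands, if message `k` is sent by the constant input `k`. -/
noncomputable def ownBandCountLaw (α T : ℝ≥0) (k : Fin M) : Measure (Fin M → ℕ) :=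
  Measure.pi fun j ↦ poissonMeasure ((if j = k then α else 1) * T)

instance (α T : ℝ≥0) (k : Fin M) : IsProbabilityMeasure (ownBandCountLaw α T k) := by
  unfold ownBandCountLaw
  infer_instance

theorem ownBandCountLaw_eq_withDensity (α T : ℝ≥0) (k : Fin M) :
    ownBandCountLaw α T k = (Measure.pi fun _ : Fin M ↦ poissonMeasure T).withDensity fun z ↦
      ENNReal.ofReal (Real.exp ((1 - α) * T)) * (α : ℝ≥0∞) ^ z k := by
  refine Measure.ext fun A hA ↦ ?_
  rw [ownBandCountLaw, pi_poissonMeasure_ite_apply α (fun _ ↦ T), withDensity_apply _ hA,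
    lintegral_const_mul _ .of_discrete, Finset.filter_eq' Finset.univ k]
  simp

theorem measurePreserving_comp_perm_ownBandCountLaw (α T : ℝ≥0) (σ : Equiv.Perm (Fin M))
    (k : Fin M) :
    MeasurePreserving (· ∘ σ) (ownBandCountLaw α T (σ k)) (ownBandCountLaw α T k) := by
  have preserving := (measurePreserving_piCongrLeft
    (fun j ↦ poissonMeasure ((if j = σ k then α else 1) * T)) σ).symm
  simp only [EmbeddingLike.apply_eq_iff_eq] at preserving
  exact preserving

theorem sum_mul_measure_singleton_eq_iSup {ι : Type*} [Fintype ι] [MeasurableSpace ι]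
    [MeasurableSingletonClass ι] (μ : Measure ι) [IsProbabilityMeasure μ] {f : ι → ℝ≥0∞}
    (hf : ∀ k, μ {k} ≠ 0 → ∀ j, f j ≤ f k) :
    ∑ k, f k * μ {k} = ⨆ k, f k := by
  have mul_eq (k : ι) : f k * μ {k} = (⨆ j, f j) * μ {k} := by
    by_cases hk : μ {k} = 0
    · simp [hk]
    · rw [le_antisymm (le_iSup f k) (iSup_le (hf k hk))]
  simp_rw [mul_eq]
  rw [← Finset.mul_sum, sum_measure_singleton, Finset.coe_univ, measure_univ, mul_one]

/-- The randomized decoder `d` decides for the message `k` with probability `d z {k}`, if the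
counts are `z`. -/
theorem sum_lintegral_ownBandCountLaw (α T : ℝ≥0) (d : (Fin M → ℕ) → Measure (Fin M))
    [∀ z, IsProbabilityMeasure (d z)]
    (hd : ∀ z k, d z {k} ≠ 0 → ∀ j, (α : ℝ≥0∞) ^ z j ≤ (α : ℝ≥0∞) ^ z k) :
    ∑ k, ∫⁻ z, d z {k} ∂ownBandCountLaw α T k = optimalScore α T M := by
  simp_rw [ownBandCountLaw_eq_withDensity, lintegral_withDensity_eq_lintegral_mul _
    Measurable.of_discrete Measurable.of_discrete, Pi.mul_apply, mul_assoc,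
    lintegral_const_mul _ Measurable.of_discrete]
  rw [← Finset.mul_sum, ← lintegral_finsetSum _ fun _ _ ↦ .of_discrete, optimalScore]
  simp_rw [fun z ↦ sum_mul_measure_singleton_eq_iSup (d z) (hd z)]

theorem sum_ownBandCountLaw_decoder (α T : ℝ≥0) {d : (Fin M → ℕ) → Fin M}
    (hd : ∀ (z : Fin M → ℕ) (j : Fin M), (α : ℝ≥0∞) ^ z j ≤ (α : ℝ≥0∞) ^ z (d z)) :
    ∑ k, ownBandCountLaw α T k {z | d z = k} = optimalScore α T M := by
  rw [← sum_lintegral_ownBandCountLaw α T (fun z ↦ Measure.dirac (d z)) fun z k hk j ↦ ?_]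
  · refine Finset.sum_congr rfl fun k _ ↦ ?_
    rw [← lintegral_indicator_one .of_discrete]
    refine lintegral_congr fun z ↦ ?_
    simp [Set.indicator_apply]
  · obtain rfl : d z = k := by simpa [Pi.single_apply, eq_comm] using hk
    exact hd z j

variable [NeZero M]

theorem exists_maximizing_decoder (α : ℝ≥0) :
    ∃ d : (Fin M → ℕ) → Fin M,
      ∀ (z : Fin M → ℕ) (j : Fin M), (α : ℝ≥0∞) ^ z j ≤ (α : ℝ≥0∞) ^ z (d z) := by
  choose d hd using fun z : Fin M → ℕ ↦ Finite.exists_max fun j ↦ (α : ℝ≥0∞) ^ z j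
  exact ⟨d, hd⟩

theorem optimalScore_le (α T : ℝ≥0) : optimalScore α T M ≤ M := by
  obtain ⟨d, hd⟩ := exists_maximizing_decoder (M := M) α
  rw [← sum_ownBandCountLaw_decoder α T hd]
  exact (Finset.sum_le_sum fun k _ ↦ prob_le_one).trans (by simp)

theorem optimalScore_ne_top (α T : ℝ≥0) : optimalScore α T M ≠ ∞ :=
  ne_top_of_le_ne_top (ENNReal.natCast_ne_top M) (optimalScore_le α T)

end OwnBand

section ErrorProbability

/-- The average error probability of a decoder whose probabilities of correct decoding, given the
messages, have the sum `optimalScore α T M`. -/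
noncomputable def optimalErrorProb (α T : ℝ≥0) (M : ℕ) : ℝ := 1 - (optimalScore α T M).toReal / M

theorem optimalErrorProb_nonneg (α T : ℝ≥0) (M : ℕ) [NeZero M] : 0 ≤ optimalErrorProb α T M := by
  refine sub_nonneg.2 (div_le_one_of_le₀ ?_ M.cast_nonneg)
  exact ENNReal.toReal_mono (ENNReal.natCast_ne_top M) (optimalScore_le α T)

theorem sum_measureReal_ne_div {Ω : Type*} [MeasurableSpace Ω] {M : ℕ} [NeZero M]
    (P : Fin M → Measure Ω) [∀ k, IsProbabilityMeasure (P k)] {d : Ω → Fin M}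
    (hd : Measurable d) :
    (∑ k, (P k).real {ω | d ω ≠ k}) / M = 1 - (∑ k, P k {ω | d ω = k}).toReal / M := by
  have real_ne (k : Fin M) : (P k).real {ω | d ω ≠ k} = 1 - (P k {ω | d ω = k}).toReal :=
    probReal_compl_eq_one_sub (hd (measurableSet_singleton k))
  have cast_ne_zero : (M : ℝ) ≠ 0 := Nat.cast_ne_zero.2 (NeZero.ne M)
  simp_rw [real_ne]
  rw [Finset.sum_sub_distrib, ENNReal.toReal_sum fun k _ ↦ measure_ne_top _ _, sub_div]
  simp [cast_ne_zero]

/-- Average the hypothesis over the cyclic shifts `i ↦ i + a` of the inclusion of `Fin m`. -/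
theorem nsmul_sum_le_of_forall_injective {R : Type*} [AddCommMonoid R] [PartialOrder R]
    [IsOrderedAddMonoid R] {m n : ℕ} [NeZero n] (hmn : m ≤ n) (p : Fin n → R) {b : R}
    (h : ∀ g : Fin m → Fin n, Function.Injective g → ∑ i, p (g i) ≤ b) :
    m • ∑ k, p k ≤ n • b :=
  calc m • ∑ k, p k = ∑ i : Fin m, ∑ a : Fin n, p (Fin.castLE hmn i + a) := by
        have sum_add (a : Fin n) : ∑ k, p (a + k) = ∑ k, p k :=
          Equiv.sum_comp (Equiv.addLeft a) p
        simp [sum_add]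
    _ = ∑ a : Fin n, ∑ i : Fin m, p (Fin.castLE hmn i + a) := Finset.sum_comm
    _ ≤ ∑ _a : Fin n, b := Finset.sum_le_sum fun a _ ↦
        h _ ((add_left_injective a).comp (Fin.castLE_injective hmn))
    _ = n • b := by simp

variable {L : ℕ∞} {T : ℝ≥0} {M : ℕ} [NeZero M]

theorem Code.optimalErrorProb_le {M' : ℕ} (hM : M ≤ M') {α : ℝ≥0} {c : Code L T M'}
    {e : ℝ} (h : c.HasErrorProb α e) : optimalErrorProb α T M ≤ e := by
  obtain ⟨P, hP, rfl⟩ := h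
  have := fun k ↦ (hP k).isProbabilityMeasure
  have : NeZero M' := ⟨((NeZero.pos M).trans_le hM).ne'⟩
  have sum_le (g : Fin M → Fin M') (hg : Function.Injective g) :
      ∑ i, P (g i) {y | c.dec y = g i} ≤ optimalScore α T M :=
    sum_measure_le_optimalScore (fun i ↦ c.measurable_enc (g i)) (fun i ↦ hP (g i))
      (fun i ↦ c.measurable_dec (measurableSet_singleton (g i))) fun i j hij ↦
        Set.disjoint_left.2 fun y hi hj ↦ hij (hg (hi.symm.trans hj))
  have mul_le : M * (∑ k, P k {y | c.dec y = k}).toReal ≤ M' * (optimalScore α T M).toReal := by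
    simpa using ENNReal.toReal_mono (by simp [ENNReal.mul_eq_top, optimalScore_ne_top])
      (nsmul_sum_le_of_forall_injective hM (fun k ↦ P k {y | c.dec y = k}) sum_le)
  rw [sum_measureReal_ne_div P c.measurable_dec, optimalErrorProb, sub_le_sub_iff_left,
    div_le_div_iff₀ (Nat.cast_pos.2 (NeZero.pos M')) (Nat.cast_pos.2 (NeZero.pos M))]
  linarith

theorem natCast_le_maxMessages_iff {α : ℝ≥0} {ε : ℝ} :
    (M : ℕ∞) ≤ maxMessages L α T ε ↔
      ∃ M' ≥ M, ∃ (c : Code L T M') (e : ℝ), c.HasErrorProb α e ∧ e ≤ ε := by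
  obtain ⟨m, rfl⟩ := Nat.exists_eq_succ_of_ne_zero (NeZero.ne M)
  rw [Nat.succ_eq_add_one, Nat.cast_add_one, ENat.add_one_le_iff (ENat.natCast_ne_top m),
    maxMessages, lt_sSup_iff]
  constructor
  · rintro ⟨_, ⟨M', -, rfl, h⟩, hM'⟩
    exact ⟨M', Nat.cast_lt.1 hM', h⟩
  · rintro ⟨M', hM', h⟩
    exact ⟨M', ⟨M', Nat.one_le_of_lt hM', rfl, h⟩, Nat.cast_lt.2 hM'⟩

theorem optError_eq_of_hasErrorProb {α : ℝ≥0} {c : Code L T M}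
    (h : c.HasErrorProb α (optimalErrorProb α T M)) :
    optError L α T M = optimalErrorProb α T M := by
  refine IsLeast.csInf_eq ⟨⟨optimalErrorProb_nonneg α T M,
    natCast_le_maxMessages_iff.2 ⟨M, le_rfl, c, _, h, le_rfl⟩⟩, ?_⟩
  rintro ε ⟨-, hε⟩
  obtain ⟨M', hM', c', e, hc', he⟩ := natCast_le_maxMessages_iff.1 hε
  exact (Code.optimalErrorProb_le hM' hc').trans he

end ErrorProbability

section Achievability

variable {L : ℕ∞} {T : ℝ≥0} {M : ℕ}

/-- The time `T`, as a point of `[0, T]`. -/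
def Time.final (T : ℝ≥0) : Time T := ⟨T, T.2, le_rfl⟩

theorem Time.start_lt_final (hT : 0 < T) : Time.start T < Time.final T :=
  Subtype.mk_lt_mk.2 (NNReal.coe_pos.2 hT)

theorem timeVolume_Ioc_start_final (T : ℝ≥0) :
    timeVolume T (Set.Ioc (Time.start T) (Time.final T)) = T := by
  have image_eq :
      Subtype.val '' Set.Ioc (Time.start T) (Time.final T) = Set.Ioc (0 : ℝ) T := by
    ext s
    exact ⟨fun ⟨_, hu, h⟩ ↦ h ▸ hu, fun hs ↦ ⟨⟨s, hs.1.le, hs.2⟩, hs, rfl⟩⟩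
  rw [timeVolume_apply, image_eq]
  simp

theorem intensityMeasure_const_Ioc_start_final (α : ℝ≥0) (i j : Band L) :
    intensityMeasure α (fun _ : Time T ↦ i) j (Set.Ioc (Time.start T) (Time.final T)) =
      (if i = j then α else 1) * T := by
  rw [intensityMeasure_apply _ _ _ measurableSet_Ioc, setLIntegral_const,
    timeVolume_Ioc_start_final]
  split_ifs <;> simp

theorem measurable_path_final_comp (f : Fin M → Band L) :
    Measurable fun (y : Output L T) j ↦ (y (f j)).1 (Time.final T) :=
  measurable_pi_lambda _ fun j ↦ (measurable_path_eval _).comp (measurable_pi_apply (f j))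

theorem hasLaw_path_final_comp (hT : 0 < T) {α : ℝ≥0} {f : Fin M → Band L}
    (hf : Function.Injective f) {k : Fin M} {P : Measure (Output L T)}
    (hP : IsOutputLaw α (fun _ ↦ f k) P) :
    HasLaw (fun (y : Output L T) j ↦ (y (f j)).1 (Time.final T)) (ownBandCountLaw α T k) P := by
  have path_start (w : CountingPath T) : w.1 (Time.start T) = 0 := w.2.1
  refine iIndepFun.hasLaw_pi (fun j ↦ ?_) ((hP.indep_bands.precomp hf).comp
    (fun _ (w : CountingPath T) ↦ w.1 (Time.final T)) fun _ ↦ measurable_path_eval _)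
  have hasLaw_increment := hP.law_increment (f j) _ _ (Time.start_lt_final hT)
  rw [toNNReal_setIntegral_intensity α measurable_const _ measurableSet_Ioc,
    intensityMeasure_const_Ioc_start_final] at hasLaw_increment
  simpa [path_start, hf.eq_iff, eq_comm] using hasLaw_increment

theorem exists_code_hasErrorProb (hT : 0 < T) (α : ℝ≥0) [NeZero M] {f : Fin M → Band L}
    (hf : Function.Injective f) :
    ∃ c : Code L T M, (∀ k t, c.enc k t = f k) ∧
      c.HasErrorProb α (optimalErrorProb α T M) := by
  obtain ⟨d, hd⟩ := exists_maximizing_decoder (M := M) α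
  let c : Code L T M :=
    { enc := fun k _ ↦ f k
      measurable_enc := fun _ ↦ measurable_const
      dec := fun y ↦ d fun j ↦ (y (f j)).1 (Time.final T)
      measurable_dec := Measurable.of_discrete.comp (measurable_path_final_comp f) }
  have isOutputLaw (k : Fin M) : IsOutputLaw α (c.enc k) (outputLaw α (c.enc k)) :=
    isOutputLaw_outputLaw α (c.measurable_enc k)
  have measure_correct (k : Fin M) :
      outputLaw α (c.enc k) {y | c.dec y = k} = ownBandCountLaw α T k {z | d z = k} := by
    rw [← (hasLaw_path_final_comp hT hf (isOutputLaw k)).map_eq,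
      Measure.map_apply (measurable_path_final_comp f) .of_discrete]
    rfl
  refine ⟨c, fun _ _ ↦ rfl, _, isOutputLaw, ?_⟩
  simp_rw [sum_measureReal_ne_div _ c.measurable_dec, measure_correct,
    sum_ownBandCountLaw_decoder α T hd, optimalErrorProb]

end Achievability

section Guess

variable {M : ℕ}

theorem uniformOn_preimage_singleton {ι : Type*} [MeasurableSpace ι] [DiscreteMeasurableSpace ι]
    (σ : Equiv.Perm ι) (A : Set ι) (k : ι) :
    uniformOn (σ ⁻¹' A) {k} = uniformOn A {σ k} := by
  have count_preimage (B : Set ι) : Measure.count (σ ⁻¹' B) = Measure.count B := by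
    rw [Measure.count_apply .of_discrete, Measure.count_apply .of_discrete,
      Set.encard_preimage_of_bijective σ.bijective]
  have preimage_inter : σ ⁻¹' A ∩ {k} = σ ⁻¹' (A ∩ {σ k}) := by ext; simp
  rw [uniformOn, uniformOn, cond_apply .of_discrete, cond_apply .of_discrete, preimage_inter,
    count_preimage, count_preimage]

theorem sum_lintegral_uniformOn (α T : ℝ≥0) {S : (Fin M → ℕ) → Set (Fin M)}
    (hne : ∀ z, (S z).Nonempty)
    (hmax : ∀ z, ∀ k ∈ S z, ∀ j, (α : ℝ≥0∞) ^ z j ≤ (α : ℝ≥0∞) ^ z k) :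
    ∑ k, ∫⁻ z, uniformOn (S z) {k} ∂ownBandCountLaw α T k = optimalScore α T M := by
  have (z : Fin M → ℕ) : IsProbabilityMeasure (uniformOn (S z)) :=
    isProbabilityMeasure_uniformOn (Set.toFinite _) (hne z)
  refine sum_lintegral_ownBandCountLaw α T (fun z ↦ uniformOn (S z)) fun z k hk ↦ hmax z k ?_
  simpa [uniformOn_eq_zero_iff (Set.toFinite _)] using hk

theorem lintegral_uniformOn_eq_of_perm (α T : ℝ≥0) {S : (Fin M → ℕ) → Set (Fin M)}
    (hperm : ∀ z (σ : Equiv.Perm (Fin M)), S (z ∘ σ) = σ ⁻¹' S z) (k l : Fin M) :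
    ∫⁻ z, uniformOn (S z) {k} ∂ownBandCountLaw α T k =
      ∫⁻ z, uniformOn (S z) {l} ∂ownBandCountLaw α T l := by
  have preserving := measurePreserving_comp_perm_ownBandCountLaw α T (Equiv.swap k l) l
  rw [← preserving.lintegral_comp (f := fun z ↦ uniformOn (S z) {l}) .of_discrete,
    Equiv.swap_apply_right]
  simp_rw [hperm, uniformOn_preimage_singleton, Equiv.swap_apply_right]

variable [NeZero M]

theorem countLaw_eq_ownBandCountLaw (α T : ℝ≥0) : countLaw α T M = ownBandCountLaw α T 0 := by
  simp only [countLaw, ownBandCountLaw, ite_mul, one_mul]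

theorem guessLaw_apply (α T : ℝ≥0) (S : (Fin M → ℕ) → Set (Fin M)) (A : Set (Fin M)) :
    guessLaw α T M S A = ∫⁻ z, uniformOn (S z) A ∂ownBandCountLaw α T 0 := by
  rw [← countLaw_eq_ownBandCountLaw]
  exact Measure.bind_apply .of_discrete Measurable.of_discrete.aemeasurable

theorem guessLaw_real_ne_zero (α T : ℝ≥0) {S : (Fin M → ℕ) → Set (Fin M)}
    (hne : ∀ z, (S z).Nonempty)
    (hmax : ∀ z, ∀ k ∈ S z, ∀ j, (α : ℝ≥0∞) ^ z j ≤ (α : ℝ≥0∞) ^ z k)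
    (hperm : ∀ z (σ : Equiv.Perm (Fin M)), S (z ∘ σ) = σ ⁻¹' S z) :
    (guessLaw α T M S).real {k | k ≠ 0} = optimalErrorProb α T M := by
  have (z : Fin M → ℕ) : IsProbabilityMeasure (uniformOn (S z)) :=
    isProbabilityMeasure_uniformOn (Set.toFinite _) (hne z)
  have : IsProbabilityMeasure (guessLaw α T M S) := ⟨by simp [guessLaw_apply]⟩
  have mul_guessLaw : M * guessLaw α T M S {0} = optimalScore α T M := by
    rw [← sum_lintegral_uniformOn α T hne hmax, guessLaw_apply]
    simp_rw [fun k ↦ lintegral_uniformOn_eq_of_perm α T hperm k 0]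
    simp
  have cast_ne_zero : (M : ℝ) ≠ 0 := Nat.cast_ne_zero.2 (NeZero.ne M)
  rw [optimalErrorProb, ← mul_guessLaw, ENNReal.toReal_mul, ENNReal.toReal_natCast,
    mul_div_cancel_left₀ _ cast_ne_zero]
  exact probReal_compl_eq_one_sub (measurableSet_singleton 0)

theorem guessLaw_argminSet {α : ℝ≥0} (hα : α ≤ 1) (T : ℝ≥0) :
    (guessLaw α T M argminSet).real {k | k ≠ 0} = optimalErrorProb α T M :=
  guessLaw_real_ne_zero α T Finite.exists_min
    (fun _ _ hk j ↦ pow_le_pow_right_of_le_one' (mod_cast hα) (hk j))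
    fun z σ ↦ by ext k; exact σ.surjective.forall (p := fun j ↦ z (σ k) ≤ z j).symm

theorem guessLaw_argmaxSet {α : ℝ≥0} (hα : 1 ≤ α) (T : ℝ≥0) :
    (guessLaw α T M argmaxSet).real {k | k ≠ 0} = optimalErrorProb α T M :=
  guessLaw_real_ne_zero α T Finite.exists_max
    (fun _ _ hk j ↦ pow_le_pow_right' (mod_cast hα) (hk j))
    fun z σ ↦ by ext k; exact σ.surjective.forall (p := fun j ↦ z j ≤ z (σ k)).symm

end Guess

section OptimalError

theorem iSup_zero_pow_eq_indicator {ι : Type*} (z : ι → ℕ) :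
    ⨆ k, (0 : ℝ≥0∞) ^ z k = (Set.univ.pi fun _ : ι ↦ ({0}ᶜ : Set ℕ))ᶜ.indicator 1 z := by
  by_cases hz : ∃ k, z k = 0
  · rw [Set.indicator_of_mem (by simpa using hz)]
    obtain ⟨k, hk⟩ := hz
    exact le_antisymm (iSup_le fun _ ↦ pow_le_one' zero_le_one _) (le_iSup_of_le k (by simp [hk]))
  · rw [Set.indicator_of_notMem (by simpa using hz)]
    push Not at hz
    simp [hz]

theorem optimalErrorProb_zero (T : ℝ≥0) (M : ℕ) :
    optimalErrorProb 0 T M =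
      1 - Real.exp T * (M : ℝ)⁻¹ * (1 - (1 - Real.exp (-T)) ^ M) := by
  have pi_real_compl : (Measure.pi fun _ : Fin M ↦ poissonMeasure T).real
      (Set.univ.pi fun _ ↦ {0}ᶜ)ᶜ = 1 - (1 - Real.exp (-T)) ^ M := by
    rw [probReal_compl_eq_one_sub .of_discrete, measureReal_def, Measure.pi_pi,
      ENNReal.toReal_prod]
    simp_rw [← measureReal_def, probReal_compl_eq_one_sub (measurableSet_singleton (0 : ℕ)),
      poissonMeasure_real_singleton]
    simp
  rw [optimalErrorProb, optimalScore, ENNReal.toReal_mul,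
    ENNReal.toReal_ofReal (Real.exp_pos _).le]
  simp_rw [ENNReal.coe_zero, iSup_zero_pow_eq_indicator]
  rw [lintegral_indicator_one .of_discrete, ← measureReal_def, pi_real_compl]
  simp only [NNReal.coe_zero, sub_zero, one_mul]
  ring

theorem exists_injective_band {L : ℕ∞} {M : ℕ} (h : (M : ℕ∞) ≤ L) :
    ∃ f : Fin M → Band L, Function.Injective f :=
  ⟨fun k ↦ ⟨k, (Nat.cast_lt.2 k.2).trans_le h⟩, fun _ _ hjk ↦ Fin.ext (Subtype.mk.inj hjk)⟩

theorem optError_eq {L : ℕ∞} {T : ℝ≥0} (hT : 0 < T) (α : ℝ≥0) {M : ℕ} [NeZero M]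
    (h : (M : ℕ∞) ≤ L) : optError L α T M = optimalErrorProb α T M := by
  obtain ⟨f, hf⟩ := exists_injective_band h
  obtain ⟨c, -, hc⟩ := exists_code_hasErrorProb hT α hf
  exact optError_eq_of_hasErrorProb hc

end OptimalError

end OCPC

theorem theorem3 (M : ℕ) [NeZero M] (T : NNReal) (hT : 0 < T) :
    (∀ (L : ℕ∞) (α : NNReal), (M : ℕ∞) ≤ L →
      (α ≤ 1 → OCPC.optError L α T M =
        (OCPC.guessLaw α T M OCPC.argminSet).real {k | k ≠ 0}) ∧
      (1 < α → OCPC.optError L α T M =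
        (OCPC.guessLaw α T M OCPC.argmaxSet).real {k | k ≠ 0}) ∧
      (∀ f : Fin M → OCPC.Band L, Function.Injective f →
        ∃ c : OCPC.Code L T M, (∀ k t, c.enc k t = f k) ∧
          c.HasErrorProb α (OCPC.optError L α T M))) ∧
    OCPC.optError ⊤ 0 T M =
      1 - Real.exp T * (M : ℝ)⁻¹ * (1 - (1 - Real.exp (-T)) ^ M) := by
  refine ⟨fun L α hL ↦ ?_, ?_⟩
  · rw [OCPC.optError_eq hT α hL]
    exact ⟨fun hα ↦ (OCPC.guessLaw_argminSet hα T).symm,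
      fun hα ↦ (OCPC.guessLaw_argmaxSet hα.le T).symm,
      fun _ hf ↦ OCPC.exists_code_hasErrorProb hT α hf⟩
  · rw [OCPC.optError_eq hT 0 le_top, OCPC.optimalErrorProb_zero]
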